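/- **Setting.** All Young diagrams have at most two rows and are written $\lambda=(\lambda_1,\lambda_2)$ with $\lambda_1\ge\lambda_2\ge0$, $|\lambda|=\lambda_1+\lambda_2$. For $\lambda\subset\mu$ let $\mathcal T(\lambda,\mu)$ be the set of paths from $\lambda$ to $\mu$ in the Young graph (successive additions of one cell), and let $H(\lambda,\mu)$ be the complex Hilbert space with orthonormal basis $\mathcal T(\lambda,\mu)$. The irreducible representation $\pi_\lambda$ of $\mathfrak S_{|\lambda|}$ is realized in $H(\emptyset,\lambda)$ (whose basis consists of the Young tableaux of shape $\lambda$) by Young's orthogonal form. Concatenation of paths gives a map $H(\emptyset,\lambda)\otimes H(\lambda,\mu)\to H(\emptyset,\mu)$, and a unit vector $h\in H(\lambda,\mu)$ determines the isometric $\mathfrak S_{|\lambda|}$-equivariant embedding $\pi_\lambda\hookrightarrow\pi_\mu$, $v\mapsto v\otimes h$. Fix $k\ge1$, put $\lambda^{(j)}=(k+j,j)$ for $j\ge 0$, and let $h=(h_0,h_1,\dots)$ be any sequence of unit vectors $h_j\in H(\lambda^{(j)},\lambda^{(j+1)})$. Let $\Pi_k(h)$ be the unitary representation of the infinite symmetric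 group $\mathfrak S_{\mathbb N}=\bigcup_N\mathfrak S_N$ that is the inductive limit (completed to a Hilbert space) of the representations $\pi_{\lambda^{(0)}},\pi_{\lambda^{(1)}},\dots$ with respect to the embeddings determined by $h_0,h_1,\dots$, and let $H_k(h)$ be its space. Let $\varepsilon\in\{0,1\}$ be the parity of $k$. Let $\mathcal T_k$ be the set of sequences $\tau=(\tau^{(\varepsilon)},\tau^{(\varepsilon+2)},\tau^{(\varepsilon+4)},\dots)$ of diagrams with $|\tau^{(n)}|=n$ and $\tau^{(n)}\subset\tau^{(n+2)}$ such that for all sufficiently large $n$ the diagram $\tau^{(n+2)}$ is obtained from $\tau^{(n)}$ by adding one cell to each row, and $\tau^{(n)}_1-\tau^{(n)}_2=k$. (Thus $\mathcal T_k=\mathcal T_k^{\rm odd}$ for odd $k$, and $\mathcal T_k=\mathcal T_k^{\rm even}$ for even $k$.) For $\tau\in\mathcal T_k$ we have $\tau^{(k+2j)}=\lambda^{(j)}$ for all large $j$, so that $h_j\in H(\tau^{(k+2j)},\tau^{(k+2j+2)})$ for these $j$. Let $H^h_\tau$ be the incomplete tensor product of the spaces $H(\tau^{(n)},\tau^{(n+2)})$,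 $n=\varepsilon,\varepsilon+2,\dots$, determined by $h$: the completion of the space of finite linear combinations of simple tensors $\bigotimes_n v_n$, $v_n\in H(\tau^{(n)},\tau^{(n+2)})$, such that $v_{k+2j}=h_j$ for all but finitely many $j$, with the inner product determined by $\langle\bigotimes v_n,\bigotimes w_n\rangle=\prod_n\langle v_n,w_n\rangle$. **Proposition.** Let $k\ge1$. Then $$H_k(h)=\bigoplus_{\tau\in\mathcal T_k}H^h_\tau$$ (orthogonal Hilbert direct sum). Precisely, there are linear isometries $U_\tau:H_\tau^h\to H_k(h)$, $\tau\in\mathcal T_k$, with mutually orthogonal ranges whose Hilbert sum is the whole of $H_k(h)$, such that $U_\tau$ is the natural identification: if $\tau^{(k+2i)}=\lambda^{(i)}$ and $v_{k+2i}=h_i$ for all $i\ge j$, then $U_\tau\bigl(\bigotimes_n v_n\bigr)$ is the image in $H_k(h)$ of the vector of $H(\emptyset,\lambda^{(j)})$ obtained by concatenation from $\bigotimes_{n<k+2j}v_n$ (for odd $k$, the unique path from $\emptyset$ to $\tau^{(1)}$ is prefixed). Moreover, for every $\tau\in\mathcal T_k$ the subspace $U_\tau(H_\tau^h)$ of $H_k(h)$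 is not invariant under the action of $\mathfrak S_{\mathbb N}$. -/

import Mathlib

noncomputable section

namespace SchurWeyl

/-- The pair `p` describes a Young diagram with rows of lengths `p.1` and `p.2`. -/
def IsDiagram (p : ℕ × ℕ) : Prop := p.2 ≤ p.1

/-- Add a cell to the first row (`r = 0`) or to the second row (`r = 1`). -/
def addCell (p : ℕ × ℕ) (r : Fin 2) : ℕ × ℕ :=
  if r = 0 then (p.1 + 1, p.2) else (p.1, p.2 + 1)

/-- The content (column minus row) of the cell that `addCell p r` adds to `p`. -/
def newContent (p : ℕ × ℕ) (r : Fin 2) : ℝ :=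
  if r = 0 then (p.1 : ℝ) else (p.2 : ℝ) - 1

/-- The word `w` (the list of the rows in which the successive cells are put) describes a path
in the Young graph (restricted to diagrams with at most two rows) from `p` to `q`. -/
def IsPath : ℕ × ℕ → List (Fin 2) → ℕ × ℕ → Prop
  | p, [], q => IsDiagram p ∧ p = q
  | p, r :: w, q => IsDiagram p ∧ IsPath (addCell p r) w q

/-- The set of paths in the Young graph from `p` to `q`. -/
abbrev YoungPath (p q : ℕ × ℕ) : Type := {w : List (Fin 2) // IsPath p w q}

theorem IsPath.length {p q : ℕ × ℕ} {w : List (Fin 2)} (hw : IsPath p w q) :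
    p.1 + p.2 + w.length = q.1 + q.2 := by
  induction w generalizing p with
  | nil => simp [IsPath] at hw; simp [hw.2]
  | cons r w ih =>
    have h1 := ih hw.2
    simp only [addCell, List.length_cons] at h1 ⊢
    split_ifs at h1 <;> simp at h1 <;> omega

instance (p q : ℕ × ℕ) : Finite (YoungPath p q) :=
  Set.Finite.subset (List.finite_length_eq (Fin 2) (q.1 + q.2 - (p.1 + p.2)))
    fun w (hw : IsPath p w q) => by
      have := hw.length
      simp only [Set.mem_ofPred_eq]
      omega

instance (p q : ℕ × ℕ) : Fintype (YoungPath p q) := Fintype.ofFinite _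

/-- The Hilbert space in which the paths from `p` to `q` form an orthonormal basis. -/
abbrev PathSpace (p q : ℕ × ℕ) : Type := EuclideanSpace ℂ (YoungPath p q)

open Classical in
/-- The coordinate of `v` at the path with word `w` (zero if `w` is not a path from `p` to `q`). -/
def coeff {p q : ℕ × ℕ} (v : PathSpace p q) (w : List (Fin 2)) : ℂ :=
  if hw : IsPath p w q then v ⟨w, hw⟩ else 0

/-- The vector of `PathSpace p q` whose coordinates are given by a function of words. -/
def ofCoeff (p q : ℕ × ℕ) (f : List (Fin 2) → ℂ) : PathSpace p q :=
  WithLp.toLp 2 fun t => f t.1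

/-- The functions of words that vanish outside of the paths from `p` to `q`. -/
def Supp (p q : ℕ × ℕ) (f : List (Fin 2) → ℂ) : Prop := ∀ w, ¬ IsPath p w q → f w = 0

theorem supp_coeff {p q : ℕ × ℕ} (v : PathSpace p q) : Supp p q (coeff v) := by
  intro w hw; simp [coeff, hw]

theorem coeff_ofCoeff {p q : ℕ × ℕ} {f : List (Fin 2) → ℂ} (hf : Supp p q f) :
    coeff (ofCoeff p q f) = f := by
  ext w
  by_cases hw : IsPath p w q
  · simp [coeff, ofCoeff, hw]
  · simp [coeff, hw, hf w hw]

theorem coeff_apply {p q : ℕ × ℕ} (v : PathSpace p q) (t : YoungPath p q) :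
    coeff v t.1 = v t := by
  simp [coeff, t.2]

theorem coeff_injective {p q : ℕ × ℕ} {u v : PathSpace p q} (h : coeff u = coeff v) : u = v := by
  ext t
  rw [← coeff_apply, ← coeff_apply, h]

theorem coeff_add {p q : ℕ × ℕ} (u v : PathSpace p q) (w : List (Fin 2)) :
    coeff (u + v) w = coeff u w + coeff v w := by
  unfold coeff; split_ifs <;> simp

theorem coeff_smul {p q : ℕ × ℕ} (c : ℂ) (v : PathSpace p q) (w : List (Fin 2)) :
    coeff (c • v) w = c * coeff v w := by
  unfold coeff; split_ifs <;> simp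

theorem finite_support_coeff {p q : ℕ × ℕ} (v : PathSpace p q) :
    (Function.support (coeff v)).Finite := by
  refine Set.Finite.subset (Set.finite_range (fun t : YoungPath p q => t.1)) ?_
  intro w hw
  by_contra h
  exact hw (supp_coeff v w fun h' => h ⟨⟨w, h'⟩, rfl⟩)

theorem inner_eq_finsum {p q : ℕ × ℕ} (u v : PathSpace p q) :
    inner ℂ u v = ∑ᶠ w, coeff v w * star (coeff u w) := by
  have hsub : (Function.support fun w => coeff v w * star (coeff u w))
      ⊆ ((Finset.univ.map ⟨fun t : YoungPath p q => t.1, Subtype.val_injective⟩ :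
          Finset (List (Fin 2))) : Set (List (Fin 2))) := by
    intro w hw
    by_cases h : IsPath p w q
    · simp [h]
    · exact absurd (by simp [supp_coeff v w h]) hw
  rw [finsum_eq_sum_of_support_subset _ hsub, Finset.sum_map, PiLp.inner_apply]
  refine Finset.sum_congr rfl fun t _ => ?_
  simp [coeff_apply]

/-! ### Young's orthogonal form -/

/-- Exchange the letters at the positions `i` and `i + 1` (counted from zero). -/
def swapAt : ℕ → List (Fin 2) → List (Fin 2)
  | 0, a :: b :: w => b :: a :: w
  | i + 1, a :: w => a :: swapAt i w
  | 0, [a] => [a]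
  | _, [] => []

/-- The axial distance between the cells number `i` and `i + 1` (counted from zero) of the path
`w` that starts at `p`: the content of the latter cell minus that of the former (and `1` if `w` is
too short to have these cells). -/
def axial : ℕ × ℕ → ℕ → List (Fin 2) → ℝ
  | p, 0, a :: b :: _ => newContent (addCell p a) b - newContent p a
  | p, i + 1, a :: w => axial (addCell p a) i w
  | _, _, _ => 1

/-- Young's orthogonal form of the Coxeter transposition of `i` and `i + 1`. -/
def youngFun (p : ℕ × ℕ) (i : ℕ) (f : List (Fin 2) → ℂ) (w : List (Fin 2)) : ℂ :=
  ((axial p i w)⁻¹ : ℝ) * f w + (√(1 - ((axial p i w)⁻¹) ^ 2) : ℝ) * f (swapAt i w)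

theorem swapAt_swapAt (i : ℕ) (w : List (Fin 2)) : swapAt i (swapAt i w) = w := by
  induction i generalizing w with
  | zero => rcases w with _ | ⟨a, _ | ⟨b, w⟩⟩ <;> rfl
  | succ i ih => rcases w with _ | ⟨a, w⟩ <;> simp [swapAt, ih]

theorem youngFun_cons (p : ℕ × ℕ) (i : ℕ) (f : List (Fin 2) → ℂ) (a : Fin 2) (w : List (Fin 2)) :
    youngFun p (i + 1) f (a :: w) = youngFun (addCell p a) i (fun v => f (a :: v)) w := rfl

theorem youngFun_nil (p : ℕ × ℕ) (i : ℕ) (f : List (Fin 2) → ℂ) : youngFun p i f [] = f [] := by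
  cases i <;> simp [youngFun, axial]

theorem youngFun_single (p : ℕ × ℕ) (f : List (Fin 2) → ℂ) (a : Fin 2) :
    youngFun p 0 f [a] = f [a] := by
  simp [youngFun, axial]

theorem addCell_comm (p : ℕ × ℕ) (a b : Fin 2) :
    addCell (addCell p a) b = addCell (addCell p b) a := by
  fin_cases a <;> fin_cases b <;> simp [addCell]

theorem Supp.cons {p q : ℕ × ℕ} {f : List (Fin 2) → ℂ} (hf : Supp p q f) (a : Fin 2) :
    Supp (addCell p a) q (fun v => f (a :: v)) :=
  fun w hw => hf _ fun h => hw h.2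

theorem IsPath.isDiagram {p q : ℕ × ℕ} {w : List (Fin 2)} (h : IsPath p w q) : IsDiagram p := by
  cases w <;> exact h.1

theorem Supp.young {p q : ℕ × ℕ} (i : ℕ) {f : List (Fin 2) → ℂ} (hf : Supp p q f) :
    Supp p q (youngFun p i f) := by
  induction i generalizing p f with
  | zero =>
    intro w hw
    rcases w with _ | ⟨a, _ | ⟨b, w⟩⟩
    · rw [youngFun_nil, hf _ hw]
    · rw [youngFun_single, hf _ hw]
    · by_cases h : IsPath p (b :: a :: w) q
      · have h1 : ¬ IsDiagram (addCell p a) := by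
          intro h2
          refine hw ⟨h.1, h2, ?_⟩
          rw [addCell_comm]
          exact h.2.2
        have hp := h.1
        have hb := h.2.1
        fin_cases a <;> fin_cases b <;>
          simp [addCell, IsDiagram] at h1 hp hb
        · omega
        · omega
        · replace hw := hf _ hw
          simp only [Fin.mk_one, Fin.zero_eta, Fin.isValue] at hw
          have e : (p.1 : ℝ) = p.2 := by
            have : p.1 = p.2 := by omega
            exact_mod_cast this
          simp [youngFun, axial, hw, newContent, addCell, e]
        · omega
      · simp [youngFun, swapAt, hf _ hw, hf _ h]
  | succ i ih =>
    intro w hw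
    rcases w with _ | ⟨a, w⟩
    · rw [youngFun_nil, hf _ hw]
    · rw [youngFun_cons]
      by_cases hp : IsDiagram p
      · exact ih (hf.cons a) _ fun h => hw ⟨hp, h⟩
      · have hz : ∀ v, f v = 0 := fun v => hf v fun h => hp h.isDiagram
        simp [youngFun, hz]

theorem youngFun_zero_zero (p : ℕ × ℕ) (f : List (Fin 2) → ℂ) (a : Fin 2) (w : List (Fin 2)) :
    youngFun p 0 f (a :: a :: w) = f (a :: a :: w) := by
  fin_cases a <;> simp [youngFun, axial, newContent, addCell]

/-- The axial distance `λ₁ - λ₂ + 1` governing the exchange of two cells in different rows. -/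
def rowDist (p : ℕ × ℕ) : ℝ := (p.1 : ℝ) - p.2 + 1

theorem youngFun_zero_01 (p : ℕ × ℕ) (f : List (Fin 2) → ℂ) (w : List (Fin 2)) :
    youngFun p 0 f (0 :: 1 :: w) =
      -((rowDist p)⁻¹ : ℝ) * f (0 :: 1 :: w) + (√(1 - ((rowDist p)⁻¹) ^ 2) : ℝ) * f (1 :: 0 :: w) := by
  have : axial p 0 (0 :: 1 :: w) = -rowDist p := by
    simp [axial, newContent, addCell, rowDist]; ring
  simp [youngFun, this, inv_neg, swapAt]

theorem youngFun_zero_10 (p : ℕ × ℕ) (f : List (Fin 2) → ℂ) (w : List (Fin 2)) :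
    youngFun p 0 f (1 :: 0 :: w) =
      ((rowDist p)⁻¹ : ℝ) * f (1 :: 0 :: w) + (√(1 - ((rowDist p)⁻¹) ^ 2) : ℝ) * f (0 :: 1 :: w) := by
  have : axial p 0 (1 :: 0 :: w) = rowDist p := by
    simp [axial, newContent, addCell, rowDist]; ring
  simp [youngFun, this, swapAt]

theorem one_le_dist {p : ℕ × ℕ} (h : IsDiagram p) : 1 ≤ rowDist p := by
  have : (p.2 : ℝ) ≤ p.1 := by exact_mod_cast h
  unfold rowDist; linarith

theorem sqrt_dist {x : ℝ} (h : 1 ≤ x) :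
    ((√(1 - (x⁻¹) ^ 2) : ℝ) : ℂ) ^ 2 = 1 - ((x⁻¹ : ℝ) : ℂ) ^ 2 := by
  rw [← Complex.ofReal_pow, Real.sq_sqrt]
  · push_cast; rfl
  · have h1 : x⁻¹ ≤ 1 := inv_le_one_of_one_le₀ h
    have h2 : 0 ≤ x⁻¹ := by positivity
    nlinarith

theorem youngFun_sq {p q : ℕ × ℕ} (i : ℕ) {f : List (Fin 2) → ℂ} (hf : Supp p q f) :
    youngFun p i (youngFun p i f) = f := by
  induction i generalizing p f with
  | zero =>
    ext w
    by_cases hp : IsDiagram p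
    swap
    · have hz : ∀ v, f v = 0 := fun v => hf v fun h => hp h.isDiagram
      simp [youngFun, hz]
    have hs := sqrt_dist (one_le_dist hp)
    rcases w with _ | ⟨a, _ | ⟨b, w⟩⟩
    · simp [youngFun_nil]
    · simp [youngFun_single]
    · fin_cases a <;> fin_cases b
      · simp [youngFun_zero_zero]
      · simp only [Fin.zero_eta, Fin.mk_one, youngFun_zero_01, youngFun_zero_10]
        linear_combination f (0 :: 1 :: w) * hs
      · simp only [Fin.zero_eta, Fin.mk_one, youngFun_zero_01, youngFun_zero_10]
        linear_combination f (1 :: 0 :: w) * hs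
      · simp [youngFun_zero_zero]
  | succ i ih =>
    ext w
    rcases w with _ | ⟨a, w⟩
    · simp [youngFun_nil]
    · rw [youngFun_cons]
      simp only [youngFun_cons]
      exact congrFun (ih (hf.cons a)) w

theorem youngFun_comm (p : ℕ × ℕ) {i j : ℕ} (hij : i + 2 ≤ j) (f : List (Fin 2) → ℂ) :
    youngFun p i (youngFun p j f) = youngFun p j (youngFun p i f) := by
  induction i generalizing p f j with
  | zero =>
    obtain ⟨j, rfl⟩ : ∃ j', j = j' + 2 := ⟨j - 2, by omega⟩
    ext w
    rcases w with _ | ⟨a, _ | ⟨b, w⟩⟩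
    · simp [youngFun_nil]
    · simp [youngFun_single, youngFun_cons, youngFun_nil]
    · have e : ∀ (c : ℕ × ℕ) (g : List (Fin 2) → ℂ), youngFun c 0 g (a :: b :: w)
          = ((newContent (addCell c a) b - newContent c a)⁻¹ : ℝ) * g (a :: b :: w)
            + (√(1 - ((newContent (addCell c a) b - newContent c a)⁻¹) ^ 2) : ℝ)
              * g (b :: a :: w) := fun _ _ => rfl
      rw [e, youngFun_cons, youngFun_cons, youngFun_cons, youngFun_cons, youngFun_cons,
        youngFun_cons, addCell_comm p b a]
      simp only [youngFun, axial, swapAt]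
      ring
  | succ i ih =>
    obtain ⟨j, rfl⟩ : ∃ j', j = j' + 1 := ⟨j - 1, by omega⟩
    ext w
    rcases w with _ | ⟨a, w⟩
    · simp [youngFun_nil]
    · simp only [youngFun_cons]
      exact congrFun (ih _ (by omega) _) w

theorem addCell_size (p : ℕ × ℕ) (a : Fin 2) :
    (addCell p a).1 + (addCell p a).2 = p.1 + p.2 + 1 := by
  unfold addCell; split_ifs <;> simp <;> omega

theorem youngFun_braid {p q : ℕ × ℕ} (i : ℕ) (hi : p.1 + p.2 + i + 3 ≤ q.1 + q.2)
    {f : List (Fin 2) → ℂ} (hf : Supp p q f) :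
    youngFun p i (youngFun p (i + 1) (youngFun p i f)) =
      youngFun p (i + 1) (youngFun p i (youngFun p (i + 1) f)) := by
  induction i generalizing p f with
  | zero =>
    ext w
    by_cases hp : IsDiagram p
    swap
    · have hz : ∀ v, f v = 0 := fun v => hf v fun h => hp h.isDiagram
      simp [youngFun, hz]
    have hshort : ∀ {v : List (Fin 2)}, v.length < 3 → ∀ {g : List (Fin 2) → ℂ}, Supp p q g →
        g v = 0 := fun {v} hv {g} hg => hg v fun h => by have := h.length; omega
    rcases w with _ | ⟨a, _ | ⟨b, _ | ⟨c, w⟩⟩⟩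
    · simp [youngFun_nil]
    · rw [hshort (by simp) (((hf.young 0).young 1).young 0),
        hshort (by simp) (((hf.young 1).young 0).young 1)]
    · rw [hshort (by simp) (((hf.young 0).young 1).young 0),
        hshort (by simp) (((hf.young 1).young 0).young 1)]
    · have hD := one_le_dist hp
      have h0 : rowDist (addCell p 0) = rowDist p + 1 := by simp [rowDist, addCell]; ring
      have h1 : rowDist (addCell p 1) = rowDist p - 1 := by simp [rowDist, addCell]; ring
      have hs := sqrt_dist hD
      have hs0 := sqrt_dist (x := rowDist p + 1) (by linarith)
      have hxy : ((rowDist p)⁻¹ : ℝ) - ((rowDist p + 1)⁻¹ : ℝ)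
          = ((rowDist p)⁻¹ : ℝ) * ((rowDist p + 1)⁻¹ : ℝ) := by
        have : rowDist p ≠ 0 := by linarith
        have : rowDist p + 1 ≠ 0 := by linarith
        field_simp; ring
      replace hxy := congrArg (fun x : ℝ => (x : ℂ)) hxy
      simp only [Complex.ofReal_sub, Complex.ofReal_mul] at hxy
      have hcase : (f (0 :: 1 :: 1 :: w) = 0 ∧ f (1 :: 0 :: 1 :: w) = 0 ∧ f (1 :: 1 :: 0 :: w) = 0)
          ∨ 2 ≤ rowDist p := by
        by_cases h : p.2 + 1 ≤ p.1
        · right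
          have : (p.2 : ℝ) + 1 ≤ p.1 := by exact_mod_cast h
          unfold rowDist; linarith
        · left
          refine ⟨hf _ fun h' => ?_, hf _ fun h' => ?_, hf _ fun h' => ?_⟩
          · have := h'.2.2.2.isDiagram
            simp [addCell, IsDiagram] at this
            omega
          · have := h'.2.isDiagram
            simp [addCell, IsDiagram] at this
            omega
          · have := h'.2.isDiagram
            simp [addCell, IsDiagram] at this
            omega
      have hzx : 2 ≤ rowDist p → (((rowDist p - 1)⁻¹ : ℝ) : ℂ) - ((rowDist p)⁻¹ : ℝ)
          = ((rowDist p - 1)⁻¹ : ℝ) * ((rowDist p)⁻¹ : ℝ) := fun h2 => by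
        have : rowDist p ≠ 0 := by linarith
        have : rowDist p - 1 ≠ 0 := by linarith
        have h3 : ((rowDist p - 1)⁻¹ : ℝ) - ((rowDist p)⁻¹ : ℝ)
            = ((rowDist p - 1)⁻¹ : ℝ) * ((rowDist p)⁻¹ : ℝ) := by
          field_simp; ring
        have h4 := congrArg (fun x : ℝ => (x : ℂ)) h3
        simpa only [Complex.ofReal_sub, Complex.ofReal_mul] using h4
      have hsz : 2 ≤ rowDist p → _ := fun h2 => sqrt_dist (x := rowDist p - 1) (by linarith)
      set x : ℂ := (((rowDist p)⁻¹ : ℝ) : ℂ) with hx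
      set y : ℂ := (((rowDist p + 1)⁻¹ : ℝ) : ℂ) with hy
      set X : ℂ := ((√(1 - ((rowDist p)⁻¹) ^ 2) : ℝ) : ℂ) with hX
      set Y : ℂ := ((√(1 - ((rowDist p + 1)⁻¹) ^ 2) : ℝ) : ℂ) with hY
      set z : ℂ := (((rowDist p - 1)⁻¹ : ℝ) : ℂ) with hz
      set Z : ℂ := ((√(1 - ((rowDist p - 1)⁻¹) ^ 2) : ℝ) : ℂ) with hZ
      fin_cases a <;> fin_cases b <;> fin_cases c <;>
        simp only [Fin.zero_eta, Fin.mk_one, youngFun_cons, youngFun_zero_zero, youngFun_zero_01,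
          youngFun_zero_10, h0, h1, ← hx, ← hy, ← hz, ← hX, ← hY, ← hZ]
      · linear_combination f (0 :: 0 :: 1 :: w) * (x * hs0 + (1 + y) * hxy)
          - f (0 :: 1 :: 0 :: w) * Y * hxy
      · linear_combination -f (0 :: 0 :: 1 :: w) * Y * hxy
          + f (0 :: 1 :: 0 :: w) * (hs - hs0 - (x + y) * hxy) + f (1 :: 0 :: 0 :: w) * X * hxy
      · rcases hcase with ⟨h3, h4, h5⟩ | h2
        · simp only [h3, h4, h5]; ring
        · linear_combination -f (0 :: 1 :: 1 :: w) * (z * hs + (1 + x) * hzx h2)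
            + f (1 :: 0 :: 1 :: w) * X * hzx h2
      · linear_combination f (0 :: 1 :: 0 :: w) * X * hxy
          + f (1 :: 0 :: 0 :: w) * (y * hs + (x - 1) * hxy)
      · rcases hcase with ⟨h3, h4, h5⟩ | h2
        · simp only [h3, h4, h5]; ring
        · linear_combination f (0 :: 1 :: 1 :: w) * X * hzx h2
            - f (1 :: 0 :: 1 :: w) * (hsz h2 - hs - (z + x) * hzx h2)
            - f (1 :: 1 :: 0 :: w) * Z * hzx h2
      · rcases hcase with ⟨h3, h4, h5⟩ | h2
        · simp only [h3, h4, h5]; ring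
        · linear_combination -f (1 :: 0 :: 1 :: w) * Z * hzx h2
            - f (1 :: 1 :: 0 :: w) * (x * hsz h2 + (z - 1) * hzx h2)
  | succ i ih =>
    ext w
    rcases w with _ | ⟨a, w⟩
    · simp [youngFun_nil]
    · simp only [youngFun_cons]
      exact congrFun (ih (by rw [addCell_size]; omega) (hf.cons a)) w

/-- The permutation of the set of words that exchanges the letters at `i` and `i + 1`. -/
def swapEquiv (i : ℕ) : List (Fin 2) ≃ List (Fin 2) :=
  ⟨swapAt i, swapAt i, swapAt_swapAt i, swapAt_swapAt i⟩

theorem sqrt_axial_swapAt (p : ℕ × ℕ) (i : ℕ) (w : List (Fin 2)) :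
    √(1 - ((axial p i (swapAt i w))⁻¹) ^ 2) = √(1 - ((axial p i w)⁻¹) ^ 2) := by
  induction i generalizing p w with
  | zero =>
    rcases w with _ | ⟨a, _ | ⟨b, w⟩⟩
    · rfl
    · rfl
    · by_cases hab : a = b
      · subst hab; rfl
      · have : axial p 0 (b :: a :: w) = -axial p 0 (a :: b :: w) := by
          fin_cases a <;> fin_cases b
          · exact absurd rfl hab
          · simp [axial, newContent, addCell]
          · simp [axial, newContent, addCell]
          · exact absurd rfl hab
        rw [swapAt, this, inv_neg, neg_sq]
  | succ i ih =>
    rcases w with _ | ⟨a, w⟩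
    · rfl
    · exact ih _ _

theorem finsum_young_symm {p q : ℕ × ℕ} (i : ℕ) (u v : PathSpace p q) :
    ∑ᶠ w, youngFun p i (coeff v) w * star (coeff u w)
      = ∑ᶠ w, coeff v w * star (youngFun p i (coeff u) w) := by
  have hu := finite_support_coeff u
  have hv := finite_support_coeff v
  have e1 : ∀ w, youngFun p i (coeff v) w * star (coeff u w)
      = ((axial p i w)⁻¹ : ℝ) * coeff v w * star (coeff u w)
        + (√(1 - ((axial p i w)⁻¹) ^ 2) : ℝ) * coeff v (swapAt i w) * star (coeff u w) := by
    intro w; simp only [youngFun]; ring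
  have e2 : ∀ w, coeff v w * star (youngFun p i (coeff u) w)
      = ((axial p i w)⁻¹ : ℝ) * coeff v w * star (coeff u w)
        + (√(1 - ((axial p i w)⁻¹) ^ 2) : ℝ) * coeff v w * star (coeff u (swapAt i w)) := by
    intro w; simp only [youngFun, star_add, star_mul', RCLike.star_def, Complex.conj_ofReal]; ring
  have f1 : (Function.support fun w =>
      (((axial p i w)⁻¹ : ℝ) : ℂ) * coeff v w * star (coeff u w)).Finite := by
    refine hv.subset fun w hw h => hw ?_
    simp [h]
  have f2 : (Function.support fun w => ((√(1 - ((axial p i w)⁻¹) ^ 2) : ℝ) : ℂ)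
      * coeff v (swapAt i w) * star (coeff u w)).Finite := by
    refine hu.subset fun w hw h => hw ?_
    simp [h]
  have f3 : (Function.support fun w => ((√(1 - ((axial p i w)⁻¹) ^ 2) : ℝ) : ℂ)
      * coeff v w * star (coeff u (swapAt i w))).Finite := by
    refine hv.subset fun w hw h => hw ?_
    simp [h]
  simp only [e1, e2]
  rw [finsum_add_distrib f1 f2, finsum_add_distrib f1 f3]
  congr 1
  rw [← finsum_comp_equiv (swapEquiv i)]
  refine finsum_congr fun w => ?_
  simp only [swapEquiv, Equiv.coe_fn_mk, swapAt_swapAt, sqrt_axial_swapAt]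

/-- The operator of Young's orthogonal form corresponding to the Coxeter transposition that
exchanges `i` and `i + 1`, in the space with basis the paths from `p` to `q`; the identity if the
paths are too short. -/
def youngOp (p q : ℕ × ℕ) (i : ℕ) : PathSpace p q →ₗᵢ[ℂ] PathSpace p q :=
  LinearMap.isometryOfInner
    { toFun := fun v => ofCoeff p q (youngFun p i (coeff v))
      map_add' := fun u v => by
        ext t
        simp only [ofCoeff, youngFun, coeff_add, PiLp.add_apply]
        ring
      map_smul' := fun c v => by
        ext t
        simp only [ofCoeff, youngFun, coeff_smul, PiLp.smul_apply, RingHom.id_apply, smul_eq_mul]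
        ring }
    (fun u v => by
      simp only [LinearMap.coe_mk, AddHom.coe_mk]
      rw [inner_eq_finsum, inner_eq_finsum, coeff_ofCoeff ((supp_coeff u).young i)]
      have h := finsum_young_symm i u (ofCoeff p q (youngFun p i (coeff v)))
      rw [coeff_ofCoeff ((supp_coeff v).young i), youngFun_sq i (supp_coeff v)] at h
      rw [coeff_ofCoeff ((supp_coeff v).young i), ← h])

theorem coeff_youngOp {p q : ℕ × ℕ} (i : ℕ) (v : PathSpace p q) :
    coeff (youngOp p q i v) = youngFun p i (coeff v) :=
  coeff_ofCoeff ((supp_coeff v).young i)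

/-- The concatenation map `H(p, q) ⊗ H(q, r) → H(p, r)`, which takes a pair of paths to their
concatenation. -/
def concat {p q r : ℕ × ℕ} (u : PathSpace p q) (h : PathSpace q r) : PathSpace p r :=
  ofCoeff p r fun w =>
    coeff u (w.take (q.1 + q.2 - (p.1 + p.2))) * coeff h (w.drop (q.1 + q.2 - (p.1 + p.2)))

theorem IsPath.append {p q r : ℕ × ℕ} {v w : List (Fin 2)} (hv : IsPath p v q)
    (hw : IsPath q w r) : IsPath p (v ++ w) r := by
  induction v generalizing p with
  | nil => obtain ⟨-, rfl⟩ := hv; exact hw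
  | cons a v ih => exact ⟨hv.1, ih hv.2⟩

theorem coeff_concat {p q r : ℕ × ℕ} (u : PathSpace p q) (h : PathSpace q r) (w : List (Fin 2)) :
    coeff (concat u h) w =
      coeff u (w.take (q.1 + q.2 - (p.1 + p.2))) * coeff h (w.drop (q.1 + q.2 - (p.1 + p.2))) := by
  refine congrFun (coeff_ofCoeff fun w hw => ?_) w
  by_contra hne
  obtain ⟨h1, h2⟩ := mul_ne_zero_iff.1 hne
  have h1' : IsPath p (w.take (q.1 + q.2 - (p.1 + p.2))) q := by
    by_contra h; exact h1 (supp_coeff u _ h)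
  have h2' : IsPath q (w.drop (q.1 + q.2 - (p.1 + p.2))) r := by
    by_contra h'; exact h2 (supp_coeff h _ h')
  exact hw (by simpa using h1'.append h2')

theorem inner_concat {p q r : ℕ × ℕ} (u v : PathSpace p q) (g h : PathSpace q r) :
    inner ℂ (concat u g) (concat v h) = inner ℂ u v * inner ℂ g h := by
  have key : inner ℂ (concat u g) (concat v h)
      = ∑ t : YoungPath p q × YoungPath q r, (v t.1 * star (u t.1)) * (h t.2 * star (g t.2)) := by
    rw [inner_eq_finsum]
    let e : YoungPath p q × YoungPath q r ↪ List (Fin 2) := ⟨fun t => t.1.1 ++ t.2.1, by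
      rintro ⟨⟨a, ha⟩, ⟨b, hb⟩⟩ ⟨⟨c, hc⟩, ⟨d, hd⟩⟩ hh
      have hl : a.length = c.length := by
        have := ha.length; have := hc.length; omega
      obtain ⟨rfl, rfl⟩ := List.append_inj hh hl
      rfl⟩
    have hsub : (Function.support fun w => coeff (concat v h) w * star (coeff (concat u g) w))
        ⊆ ((Finset.univ.map e : Finset (List (Fin 2))) : Set (List (Fin 2))) := by
      intro w hw
      simp only [Function.mem_support, coeff_concat] at hw
      have h0 := (mul_ne_zero_iff.1 (mul_ne_zero_iff.1 hw).1)
      have h1 : IsPath p (w.take (q.1 + q.2 - (p.1 + p.2))) q := by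
        by_contra h'; exact h0.1 (supp_coeff v _ h')
      have h2 : IsPath q (w.drop (q.1 + q.2 - (p.1 + p.2))) r := by
        by_contra h'; exact h0.2 (supp_coeff h _ h')
      simp only [Finset.coe_map, Set.mem_image]
      exact ⟨(⟨_, h1⟩, ⟨_, h2⟩), by simp, List.take_append_drop _ w⟩
    rw [finsum_eq_sum_of_support_subset _ hsub, Finset.sum_map]
    refine Finset.sum_congr rfl fun t _ => ?_
    have hl : q.1 + q.2 - (p.1 + p.2) = t.1.1.length := by have := t.1.2.length; omega
    have ht : e t = t.1.1 ++ t.2.1 := rfl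
    simp only [ht, coeff_concat, hl, List.take_left, List.drop_left, coeff_apply, star_mul']
    ring
  rw [key, Fintype.sum_prod_type, PiLp.inner_apply, PiLp.inner_apply, Finset.sum_mul_sum]
  rfl

/-- The isometric embedding `H(p, q) → H(p, r)` determined by a unit vector of `H(q, r)`. -/
def embed {p q r : ℕ × ℕ} (h : PathSpace q r) (hh : ‖h‖ = 1) :
    PathSpace p q →ₗᵢ[ℂ] PathSpace p r :=
  LinearMap.isometryOfInner
    { toFun := fun u => concat u h
      map_add' := fun u v => coeff_injective <| by
        ext w; simp only [coeff_concat, coeff_add]; ring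
      map_smul' := fun c v => coeff_injective <| by
        ext w; simp only [coeff_concat, coeff_smul, RingHom.id_apply]; ring }
    (fun u v => by
      simp only [LinearMap.coe_mk, AddHom.coe_mk]
      rw [inner_concat, inner_self_eq_norm_sq_to_K, hh]
      simp)

theorem embed_youngOp {p q r : ℕ × ℕ} (h : PathSpace q r) (hh : ‖h‖ = 1) (i : ℕ)
    (hi : p.1 + p.2 + i + 2 ≤ q.1 + q.2) (v : PathSpace p q) :
    embed h hh (youngOp p q i v) = youngOp p r i (embed h hh v) := by
  have hax : ∀ (i n : ℕ) (p : ℕ × ℕ) (w : List (Fin 2)), i + 2 ≤ n →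
      axial p i (w.take n) = axial p i w ∧ swapAt i (w.take n) = (swapAt i w).take n ∧
        (swapAt i w).drop n = w.drop n := by
    intro i
    induction i with
    | zero =>
      intro n p w hn
      obtain ⟨n, rfl⟩ : ∃ m, n = m + 2 := ⟨n - 2, by omega⟩
      rcases w with _ | ⟨a, _ | ⟨b, w⟩⟩ <;> simp [axial, swapAt]
    | succ i ih =>
      intro n p w hn
      obtain ⟨n, rfl⟩ : ∃ m, n = m + 1 := ⟨n - 1, by omega⟩
      rcases w with _ | ⟨a, w⟩
      · simp [swapAt]
      · simpa [axial, swapAt] using ih n (addCell p a) w (by omega)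
  apply coeff_injective
  ext w
  obtain ⟨h1, h2, h3⟩ := hax i (q.1 + q.2 - (p.1 + p.2)) p w (by omega)
  change coeff (concat (youngOp p q i v) h) w = coeff (youngOp p r i (concat v h)) w
  rw [coeff_youngOp, coeff_concat, coeff_youngOp]
  simp only [youngFun, coeff_concat, h1, h2, h3]
  ring

/-! ### The infinite symmetric group -/

/-- The infinite symmetric group: the union of the groups of permutations of `{0, ..., N - 1}`. -/
def InfSym : Subgroup (Equiv.Perm ℕ) where
  carrier := {σ | ∃ N, ∀ n, N ≤ n → σ n = n}
  one_mem' := ⟨0, fun _ _ => rfl⟩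
  mul_mem' := by
    rintro σ τ ⟨N, hN⟩ ⟨M, hM⟩
    refine ⟨max N M, fun n hn => ?_⟩
    rw [Equiv.Perm.mul_apply, hM n (le_trans (le_max_right _ _) hn),
      hN n (le_trans (le_max_left _ _) hn)]
  inv_mem' := by
    rintro σ ⟨N, hN⟩
    exact ⟨N, fun n hn => by rw [Equiv.Perm.inv_eq_iff_eq, hN n hn]⟩

/-- The Coxeter transposition of `i` and `i + 1`. -/
def coxeter (i : ℕ) : InfSym :=
  ⟨Equiv.swap i (i + 1), i + 2, fun n hn =>
    Equiv.swap_apply_of_ne_of_ne (by omega) (by omega)⟩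

section Presentation

variable {G : Type*} [Group G]

/-- The Coxeter relations of type `A`. -/
structure CoxeterRel (g : ℕ → G) : Prop where
  sq : ∀ i, g i * g i = 1
  comm : ∀ i j, i + 2 ≤ j → g i * g j = g j * g i
  braid : ∀ i, g i * g (i + 1) * g i = g (i + 1) * g i * g (i + 1)

/-- The product `g m * g (m + 1) * ... * g (m + n - 1)`. -/
def cyc (g : ℕ → G) (m : ℕ) : ℕ → G
  | 0 => 1
  | n + 1 => cyc g m n * g (m + n)

theorem cyc_succ (g : ℕ → G) (m n : ℕ) : cyc g m (n + 1) = g m * cyc g (m + 1) n := by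
  induction n with
  | zero => simp [cyc]
  | succ n ih =>
    rw [cyc, ih, cyc, mul_assoc]
    congr 3; omega

theorem CoxeterRel.cyc_comm {g : ℕ → G} (hg : CoxeterRel g) {i m : ℕ} (n : ℕ) (h : i + 2 ≤ m) :
    g i * cyc g m n = cyc g m n * g i := by
  induction n with
  | zero => simp [cyc]
  | succ n ih =>
    rw [cyc, ← mul_assoc, ih, mul_assoc, hg.comm i (m + n) (by omega), mul_assoc]

theorem CoxeterRel.cyc_shift {g : ℕ → G} (hg : CoxeterRel g) {i m n : ℕ} (h : m ≤ i)
    (h' : i + 2 ≤ m + n) : g (i + 1) * cyc g m n = cyc g m n * g i := by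
  induction n with
  | zero => omega
  | succ n ih =>
    rcases Nat.lt_or_ge (m + n) (i + 2) with h1 | h1
    · obtain ⟨l, rfl⟩ : ∃ l, n = l + 1 := ⟨n - 1, by omega⟩
      have hi : i = m + l := by omega
      subst hi
      have hc : g (m + l + 1) * cyc g m l = cyc g m l * g (m + l + 1) := by
        clear ih h h' h1
        have : ∀ n, n ≤ l → g (m + l + 1) * cyc g m n = cyc g m n * g (m + l + 1) := by
          intro n hn
          induction n with
          | zero => simp [cyc]
          | succ n ihn =>
            rw [cyc, ← mul_assoc, ihn (by omega), mul_assoc,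
              ← hg.comm (m + n) (m + l + 1) (by omega), mul_assoc]
        exact this l le_rfl
      have hb := hg.braid (m + l)
      rw [cyc, cyc, ← mul_assoc, ← mul_assoc, hc, ← add_assoc]
      simp only [mul_assoc] at hb ⊢
      rw [hb]
    · rw [cyc, ← mul_assoc, ih (by omega), mul_assoc, hg.comm i (m + n) h1, mul_assoc]

theorem coxeter_rel : CoxeterRel coxeter where
  sq i := Subtype.ext (Equiv.swap_mul_self _ _)
  comm i j h := by
    apply Subtype.ext
    ext x
    simp only [coxeter, Subgroup.coe_mul, Equiv.Perm.mul_apply, Equiv.swap_apply_def]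
    grind
  braid i := by
    apply Subtype.ext
    ext x
    simp only [coxeter, Subgroup.coe_mul, Equiv.Perm.mul_apply, Equiv.swap_apply_def]
    grind

theorem cyc_coxeter_apply (m n : ℕ) : (cyc coxeter m n).1 (m + n) = m := by
  induction n with
  | zero => rfl
  | succ n ih =>
    rw [cyc, Subgroup.coe_mul, Equiv.Perm.mul_apply]
    have : (coxeter (m + n)).1 (m + (n + 1)) = m + n := Equiv.swap_apply_right _ _
    rw [this, ih]

theorem cyc_coxeter_apply_of_lt (m n : ℕ) {x : ℕ} (hx : m + n < x) :
    (cyc coxeter m n).1 x = x := by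
  induction n with
  | zero => rfl
  | succ n ih =>
    rw [cyc, Subgroup.coe_mul, Equiv.Perm.mul_apply]
    have : (coxeter (m + n)).1 x = x :=
      Equiv.swap_apply_of_ne_of_ne (by omega) (by omega)
    rw [this, ih (by omega)]

/-- The product of the `g i` along the normal form of a permutation of `{0, ..., N - 1}`. -/
def normalForm (g : ℕ → G) : ℕ → InfSym → G
  | 0, _ => 1
  | N + 1, σ => cyc g (σ.1 N) (N - σ.1 N) *
      normalForm g N ((cyc coxeter (σ.1 N) (N - σ.1 N))⁻¹ * σ)

theorem apply_le {σ : InfSym} {N : ℕ} (h : ∀ n, N + 1 ≤ n → σ.1 n = n) : σ.1 N ≤ N := by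
  by_contra hlt
  have := h (σ.1 N) (by omega)
  have := σ.1.injective this
  omega

theorem reduce_apply {σ : InfSym} {N : ℕ} (h : ∀ n, N + 1 ≤ n → σ.1 n = n) (n : ℕ) (hn : N ≤ n) :
    ((cyc coxeter (σ.1 N) (N - σ.1 N))⁻¹ * σ).1 n = n := by
  have hle := apply_le h
  rw [Subgroup.coe_mul, Equiv.Perm.mul_apply, Subgroup.coe_inv, Equiv.Perm.inv_eq_iff_eq]
  rcases hn.eq_or_lt with rfl | hlt
  · have := cyc_coxeter_apply (σ.1 N) (N - σ.1 N)
    rw [Nat.add_sub_cancel' hle] at this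
    exact this.symm
  · rw [h n hlt, cyc_coxeter_apply_of_lt _ _ (by omega)]

theorem normalForm_mul {g : ℕ → G} (hg : CoxeterRel g) (N : ℕ) (σ : InfSym)
    (h : ∀ n, N ≤ n → σ.1 n = n) (i : ℕ) (hi : i + 1 < N) :
    normalForm g N (coxeter i * σ) = g i * normalForm g N σ := by
  induction N generalizing σ i with
  | zero => omega
  | succ N ih =>
    have hle := apply_le h
    have hred := reduce_apply h
    have hm : (coxeter i * σ).1 N = Equiv.swap i (i + 1) (σ.1 N) := rfl
    rw [normalForm, normalForm, hm]
    generalize σ.1 N = m at *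
    have sqc := coxeter_rel.sq i
    have inv_c : (coxeter i)⁻¹ = coxeter i := inv_eq_of_mul_eq_one_left sqc
    rcases lt_trichotomy m i with h1 | rfl | h1
    · rw [Equiv.swap_apply_of_ne_of_ne (by omega) (by omega)]
      obtain ⟨j, rfl⟩ : ∃ j, i = j + 1 := ⟨i - 1, by omega⟩
      have e1 := coxeter_rel.cyc_shift (i := j) (m := m) (n := N - m) (by omega) (by omega)
      have e2 := hg.cyc_shift (i := j) (m := m) (n := N - m) (by omega) (by omega)
      have e3 : (cyc coxeter m (N - m))⁻¹ * (coxeter (j + 1) * σ)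
          = coxeter j * ((cyc coxeter m (N - m))⁻¹ * σ) := by
        rw [← mul_assoc, ← mul_assoc]
        congr 1
        rw [inv_mul_eq_iff_eq_mul, ← mul_assoc, ← e1, mul_assoc, mul_inv_cancel, mul_one]
      rw [e3, ih _ hred j (by omega), ← mul_assoc, ← e2, mul_assoc]
    · rw [Equiv.swap_apply_left]
      have hN : N - m = (N - (m + 1)) + 1 := by omega
      have e1 : cyc coxeter m (N - m) = coxeter m * cyc coxeter (m + 1) (N - (m + 1)) := by
        rw [hN, cyc_succ]
      have e2 : cyc g m (N - m) = g m * cyc g (m + 1) (N - (m + 1)) := by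
        rw [hN, cyc_succ]
      rw [e1, e2, mul_inv_rev, inv_c]
      simp only [mul_assoc]
      rw [← mul_assoc (g m) (g m), hg.sq, one_mul]
    · rcases Nat.eq_or_lt_of_le h1 with h2 | h2
      · have h3 : m = i + 1 := by omega
        subst h3
        rw [Equiv.swap_apply_right]
        have hN : N - i = (N - (i + 1)) + 1 := by omega
        have e1 : cyc coxeter i (N - i) = coxeter i * cyc coxeter (i + 1) (N - (i + 1)) := by
          rw [hN, cyc_succ]
        have e2 : cyc g i (N - i) = g i * cyc g (i + 1) (N - (i + 1)) := by
          rw [hN, cyc_succ]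
        rw [e1, e2, mul_inv_rev, inv_c]
        simp only [mul_assoc]
        rw [← mul_assoc (coxeter i) (coxeter i), sqc, one_mul]
      · rw [Equiv.swap_apply_of_ne_of_ne (by omega) (by omega)]
        have e1 := coxeter_rel.cyc_comm (i := i) (m := m) (N - m) (by omega)
        have e2 := hg.cyc_comm (i := i) (m := m) (N - m) (by omega)
        have e3 : (cyc coxeter m (N - m))⁻¹ * (coxeter i * σ)
            = coxeter i * ((cyc coxeter m (N - m))⁻¹ * σ) := by
          rw [← mul_assoc, ← mul_assoc]
          congr 1
          rw [inv_mul_eq_iff_eq_mul, ← mul_assoc, ← e1, mul_assoc, mul_inv_cancel, mul_one]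
        rw [e3, ih _ hred i (by omega), ← mul_assoc, ← e2, mul_assoc]

theorem normalForm_succ (g : ℕ → G) {N M : ℕ} (hNM : N ≤ M) (σ : InfSym)
    (h : ∀ n, N ≤ n → σ.1 n = n) : normalForm g M σ = normalForm g N σ := by
  induction M, hNM using Nat.le_induction with
  | base => rfl
  | succ M hM ih =>
    rw [normalForm, h M hM, Nat.sub_self]
    simpa [cyc] using ih

/-- The Coxeter transpositions generate the infinite symmetric group. -/
theorem closure_coxeter (P : InfSym → Prop) (h1 : P 1)
    (hmul : ∀ i σ, P σ → P (coxeter i * σ)) (σ : InfSym) : P σ := by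
  obtain ⟨N, hN⟩ := σ.2
  induction N generalizing σ with
  | zero =>
    have : σ = 1 := Subtype.ext (Equiv.ext fun n => hN n (Nat.zero_le n))
    rwa [this]
  | succ N ih =>
    have h2 := ih _ (reduce_apply hN)
    have h3 : ∀ m n τ, P τ → P (cyc coxeter m n * τ) := by
      intro m n
      induction n with
      | zero => intro τ hτ; simpa [cyc] using hτ
      | succ n ihn => intro τ hτ; rw [cyc, mul_assoc]; exact ihn _ (hmul _ _ hτ)
    have h4 := h3 (σ.1 N) (N - σ.1 N) _ h2
    rwa [mul_inv_cancel_left] at h4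

theorem exists_lift {g : ℕ → G} (hg : CoxeterRel g) :
    ∃ φ : InfSym →* G, ∀ i, φ (coxeter i) = g i := by
  let F : InfSym → G := fun σ => normalForm g σ.2.choose σ
  have hF : ∀ (σ : InfSym) (N : ℕ), (∀ n, N ≤ n → σ.1 n = n) → F σ = normalForm g N σ := by
    intro σ N hN
    rcases le_total N σ.2.choose with h | h
    · exact normalForm_succ g h σ hN
    · exact (normalForm_succ g h σ σ.2.choose_spec).symm
  have hF1 : F 1 = 1 := hF 1 0 fun _ _ => rfl
  have hstep : ∀ i σ, F (coxeter i * σ) = g i * F σ := by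
    intro i σ
    obtain ⟨N, hN⟩ := σ.2
    have h1 : ∀ n, N + i + 2 ≤ n → σ.1 n = n := fun n hn => hN n (by omega)
    have h2 : ∀ n, N + i + 2 ≤ n → (coxeter i * σ).1 n = n := by
      intro n hn
      rw [Subgroup.coe_mul, Equiv.Perm.mul_apply, h1 n hn]
      exact Equiv.swap_apply_of_ne_of_ne (by omega) (by omega)
    rw [hF _ _ h1, hF _ _ h2]
    exact normalForm_mul hg _ σ h1 i (by omega)
  have hmul : ∀ σ τ, F (σ * τ) = F σ * F τ := by
    intro σ τ
    induction σ using closure_coxeter with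
    | h1 => rw [hF1, one_mul, one_mul]
    | hmul i σ ih => rw [mul_assoc, hstep, hstep, ih, mul_assoc]
  refine ⟨⟨⟨F, hF1⟩, hmul⟩, fun i => ?_⟩
  have := hstep i 1
  rw [mul_one, hF1, mul_one] at this
  exact this

/-- The homomorphism from the infinite symmetric group that takes the Coxeter transpositions to
given elements satisfying the Coxeter relations. -/
def liftCoxeter (g : ℕ → G) (hg : CoxeterRel g) : InfSym →* G := (exists_lift hg).choose

theorem liftCoxeter_coxeter (g : ℕ → G) (hg : CoxeterRel g) (i : ℕ) :
    liftCoxeter g hg (coxeter i) = g i := (exists_lift hg).choose_spec i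

end Presentation

open Filter

/-! ### Inductive limits of Hilbert spaces -/

/-- The extension of an isometry to the completion. -/
def completionMap {V : Type} [SeminormedAddCommGroup V] [InnerProductSpace ℂ V]
    (f : V →ₗᵢ[ℂ] V) : UniformSpace.Completion V →ₗᵢ[ℂ] UniformSpace.Completion V where
  toFun := UniformSpace.Completion.map f
  map_add' := by
    have hu := f.isometry.uniformContinuous
    have hc : Continuous (UniformSpace.Completion.map f) := UniformSpace.Completion.continuous_map
    intro u v
    induction u, v using UniformSpace.Completion.induction_on₂ with
    | hp =>
      exact isClosed_eq (hc.comp continuous_add)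
        ((hc.comp continuous_fst).add (hc.comp continuous_snd))
    | ih u v =>
      rw [← UniformSpace.Completion.coe_add, UniformSpace.Completion.map_coe hu,
        UniformSpace.Completion.map_coe hu, UniformSpace.Completion.map_coe hu, map_add,
        UniformSpace.Completion.coe_add]
  map_smul' := by
    have hu := f.isometry.uniformContinuous
    have hc : Continuous (UniformSpace.Completion.map f) := UniformSpace.Completion.continuous_map
    intro c v
    induction v using UniformSpace.Completion.induction_on with
    | hp => exact isClosed_eq (hc.comp (continuous_const_smul c)) (hc.const_smul c)
    | ih v =>
      rw [← UniformSpace.Completion.coe_smul, UniformSpace.Completion.map_coe hu,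
        UniformSpace.Completion.map_coe hu, map_smul, UniformSpace.Completion.coe_smul]
      rfl
  norm_map' := by
    have hu := f.isometry.uniformContinuous
    have hc : Continuous (UniformSpace.Completion.map f) := UniformSpace.Completion.continuous_map
    intro v
    induction v using UniformSpace.Completion.induction_on with
    | hp => exact isClosed_eq hc.norm continuous_norm
    | ih v =>
      change ‖UniformSpace.Completion.map f (v : UniformSpace.Completion V)‖ = _
      rw [UniformSpace.Completion.map_coe hu, UniformSpace.Completion.norm_coe,
        UniformSpace.Completion.norm_coe, LinearIsometry.norm_map]

theorem completionMap_coe {V : Type} [SeminormedAddCommGroup V] [InnerProductSpace ℂ V]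
    (f : V →ₗᵢ[ℂ] V) (v : V) :
    completionMap f (v : UniformSpace.Completion V) = (f v : UniformSpace.Completion V) :=
  UniformSpace.Completion.map_coe f.isometry.uniformContinuous v

section Limit

variable {E : ℕ → Type} [∀ j, NormedAddCommGroup (E j)] [∀ j, InnerProductSpace ℂ (E j)]

/-- The sequences that are eventually coherent with respect to the embeddings `φ j`. -/
def coherent (φ : ∀ j, E j →ₗᵢ[ℂ] E (j + 1)) : Submodule ℂ (∀ j, E j) where
  carrier := {v | ∀ᶠ j in atTop, v (j + 1) = φ j (v j)}
  zero_mem' := by simp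
  add_mem' := by
    intro u v hu hv
    filter_upwards [hu, hv] with j h1 h2
    simp [h1, h2]
  smul_mem' := by
    intro c v hv
    filter_upwards [hv] with j h
    simp [h]

/-- The algebraic inductive limit, represented by eventually coherent sequences; two sequences
that eventually coincide are at distance zero. -/
def PreLimit (φ : ∀ j, E j →ₗᵢ[ℂ] E (j + 1)) : Type := coherent φ

variable (φ : ∀ j, E j →ₗᵢ[ℂ] E (j + 1))

instance : AddCommGroup (PreLimit φ) := inferInstanceAs (AddCommGroup (coherent φ))
instance : Module ℂ (PreLimit φ) := inferInstanceAs (Module ℂ (coherent φ))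

variable {φ} in
/-- The sequence that represents an element. -/
def PreLimit.seq (u : PreLimit φ) : ∀ j, E j := Subtype.val (p := (· ∈ coherent φ)) u

variable {φ} in
theorem PreLimit.eventually (u : PreLimit φ) : ∀ᶠ j in atTop, u.seq (j + 1) = φ j (u.seq j) :=
  Subtype.property (p := (· ∈ coherent φ)) u

/-- The element represented by an eventually coherent sequence. -/
def PreLimit.mk (v : ∀ j, E j) (hv : ∀ᶠ j in atTop, v (j + 1) = φ j (v j)) : PreLimit φ :=
  (⟨v, hv⟩ : coherent φ)

theorem exists_limit_eq {a : ℕ → ℂ} (h : ∀ᶠ j in atTop, a (j + 1) = a j) :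
    ∀ᶠ j in atTop, limUnder atTop a = a j := by
  obtain ⟨N, hN⟩ := eventually_atTop.1 h
  have hc : ∀ j, N ≤ j → a j = a N := by
    intro j hj
    induction j, hj using Nat.le_induction with
    | base => rfl
    | succ j hj ih => rw [hN j hj, ih]
  have ht : Tendsto a atTop (nhds (a N)) :=
    tendsto_const_nhds.congr' (eventually_atTop.2 ⟨N, fun j hj => (hc j hj).symm⟩)
  filter_upwards [eventually_ge_atTop N] with j hj
  rw [ht.limUnder_eq, hc j hj]

/-- The inner product of two eventually coherent sequences: the eventual value of the inner
products of their members. -/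
def limitInner (u v : PreLimit φ) : ℂ := limUnder atTop fun j => inner ℂ (u.seq j) (v.seq j)

theorem limitInner_eventually (u v : PreLimit φ) :
    ∀ᶠ j in atTop, limitInner φ u v = inner ℂ (u.seq j) (v.seq j) := by
  refine exists_limit_eq ?_
  filter_upwards [u.eventually, v.eventually] with j h1 h2
  rw [h1, h2, LinearIsometry.inner_map_map]

/-- The pre-inner product on eventually coherent sequences. -/
@[reducible]
def limitCore : PreInnerProductSpace.Core ℂ (PreLimit φ) where
  inner := limitInner φ
  conj_inner_symm u v := by
    obtain ⟨j, h1, h2⟩ := ((limitInner_eventually φ u v).and (limitInner_eventually φ v u)).exists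
    rw [h1, h2, inner_conj_symm]
  re_inner_nonneg u := by
    obtain ⟨j, h⟩ := (limitInner_eventually φ u u).exists
    rw [h]
    exact inner_self_nonneg
  add_left u v w := by
    obtain ⟨j, ⟨h1, h2⟩, h3⟩ := (((limitInner_eventually φ u w).and
      (limitInner_eventually φ v w)).and (limitInner_eventually φ (u + v) w)).exists
    rw [h1, h2, h3]
    exact inner_add_left _ _ _
  smul_left u v c := by
    obtain ⟨j, h1, h2⟩ := ((limitInner_eventually φ u v).and
      (limitInner_eventually φ (c • u) v)).exists
    rw [h1, h2]
    exact inner_smul_left _ _ _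

instance : SeminormedAddCommGroup (PreLimit φ) :=
  InnerProductSpace.Core.toSeminormedAddCommGroup (c := limitCore φ)

instance : InnerProductSpace ℂ (PreLimit φ) := InnerProductSpace.ofCore (limitCore φ)

theorem preLimit_inner (u v : PreLimit φ) : inner ℂ u v = limitInner φ u v := rfl

/-- The inductive limit (in the category of Hilbert spaces) of the spaces `E j` with respect to the
isometric embeddings `φ j`. -/
abbrev HilbertLimit : Type := UniformSpace.Completion (PreLimit φ)

/-- The coherent sequence that starts with the element `v` at the level `j`. -/
def fromLevel (j : ℕ) (v : E j) : ∀ i, E i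
  | 0 => Pi.single j v 0
  | i + 1 => Pi.single j v (i + 1) + φ i (fromLevel j v i)

theorem fromLevel_mem (j : ℕ) (v : E j) : fromLevel φ j v ∈ coherent φ := by
  refine eventually_atTop.2 ⟨j, fun i hi => ?_⟩
  rw [fromLevel, Pi.single_eq_of_ne (by omega), zero_add]

/-- The canonical map of `E j` to the inductive limit. -/
def toLimit (j : ℕ) (v : E j) : HilbertLimit φ :=
  ((PreLimit.mk φ (fromLevel φ j v) (fromLevel_mem φ j v) : PreLimit φ) :
    UniformSpace.Completion (PreLimit φ))

variable {φ}

/-- The map of sequences defined by a family of isometries that is eventually compatible with the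
embeddings. -/
def preMap (T : ∀ j, E j →ₗᵢ[ℂ] E j)
    (hT : ∀ᶠ j in atTop, ∀ v, φ j (T j v) = T (j + 1) (φ j v)) : PreLimit φ →ₗᵢ[ℂ] PreLimit φ :=
  LinearMap.isometryOfInner
    { toFun := fun v => PreLimit.mk φ (fun j => T j (v.seq j)) (by
        filter_upwards [v.eventually, hT] with j h1 h2
        rw [h1, h2])
      map_add' := fun u v => Subtype.ext (funext fun j => map_add (T j) (u.seq j) (v.seq j))
      map_smul' := fun c v => Subtype.ext (funext fun j => map_smul (T j) c (v.seq j)) }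
    (fun u v => by
      refine congrArg (limUnder atTop) (funext fun j => ?_)
      exact (T j).inner_map_map (u.seq j) (v.seq j))

/-- The isometry of the inductive limit defined by a family of isometries that is eventually
compatible with the embeddings. -/
def limitMap (T : ∀ j, E j →ₗᵢ[ℂ] E j)
    (hT : ∀ᶠ j in atTop, ∀ v, φ j (T j v) = T (j + 1) (φ j v)) :
    HilbertLimit φ →ₗᵢ[ℂ] HilbertLimit φ :=
  completionMap (preMap T hT)

theorem limitMap_coe (T : ∀ j, E j →ₗᵢ[ℂ] E j)
    (hT : ∀ᶠ j in atTop, ∀ v, φ j (T j v) = T (j + 1) (φ j v)) (v : PreLimit φ) :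
    limitMap T hT (v : HilbertLimit φ) = (preMap T hT v : HilbertLimit φ) :=
  completionMap_coe _ v

theorem coe_eq_of_eventually {u v : PreLimit φ} (h : ∀ᶠ j in atTop, u.seq j = v.seq j) :
    (u : HilbertLimit φ) = (v : HilbertLimit φ) := by
  rw [← sub_eq_zero, ← UniformSpace.Completion.coe_sub, ← norm_eq_zero,
    UniformSpace.Completion.norm_coe, ← sq_eq_zero_iff, ← inner_self_eq_norm_sq (𝕜 := ℂ),
    preLimit_inner]
  obtain ⟨j, h1, h2⟩ := (h.and (limitInner_eventually φ (u - v) (u - v))).exists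
  have h3 : (u - v).seq j = 0 := by
    change u.seq j - v.seq j = 0
    rw [h1, sub_self]
  rw [h2, h3]
  simp

theorem limit_ext {S T : HilbertLimit φ →ₗᵢ[ℂ] HilbertLimit φ}
    (h : ∀ v : PreLimit φ, S (v : HilbertLimit φ) = T (v : HilbertLimit φ)) : S = T := by
  ext v
  induction v using UniformSpace.Completion.induction_on with
  | hp => exact isClosed_eq S.continuous T.continuous
  | ih v => exact h v

end Limit

/-! ### Incomplete tensor products -/

section Tensor

variable {H : ℕ → Type} [∀ n, NormedAddCommGroup (H n)] [∀ n, InnerProductSpace ℂ (H n)]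

/-- The sequences of vectors all but finitely many of whose members coincide with those of a given
sequence. -/
def StabSeq (h : ∀ n, H n) : Type := {v : ∀ n, H n // ∀ᶠ n in atTop, v n = h n}

/-- The finite formal linear combinations of simple tensors. The hypothesis says that all but
finitely many of the stabilizing vectors are unit vectors. -/
def PreTensor (h : ∀ n, H n) (_ : ∀ᶠ n in atTop, ‖h n‖ = 1) : Type := StabSeq h →₀ ℂ

variable (h : ∀ n, H n) (hh : ∀ᶠ n in atTop, ‖h n‖ = 1)

instance : AddCommGroup (PreTensor h hh) := inferInstanceAs (AddCommGroup (StabSeq h →₀ ℂ))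
instance : Module ℂ (PreTensor h hh) := inferInstanceAs (Module ℂ (StabSeq h →₀ ℂ))

/-- The inner products of simple tensors: the product of the inner products of the factors (all
but finitely many of which are equal to one). -/
def tensorKernel : Matrix (StabSeq h) (StabSeq h) ℂ :=
  Matrix.of fun v w => ∏ᶠ n, inner ℂ (v.1 n) (w.1 n)

variable {h}

theorem tensorKernel_eventually (hh : ∀ᶠ n in atTop, ‖h n‖ = 1) (v w : StabSeq h) :
    ∀ᶠ N in atTop, tensorKernel h v w = ∏ n ∈ Finset.range N, inner ℂ (v.1 n) (w.1 n) := by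
  obtain ⟨M, hM⟩ := eventually_atTop.1 ((hh.and v.2).and w.2)
  refine eventually_atTop.2 ⟨M, fun N hN => ?_⟩
  refine finprod_eq_prod_of_mulSupport_subset _ fun n hn => ?_
  by_contra hlt
  have hn' : M ≤ n := by simp at hlt; omega
  obtain ⟨⟨h1, h2⟩, h3⟩ := hM n hn'
  refine hn ?_
  simp [h2, h3, inner_self_eq_norm_sq_to_K, h1]

open scoped ComplexOrder in
theorem gram_posSemidef {ι K : Type} [NormedAddCommGroup K] [InnerProductSpace ℂ K] (v : ι → K) :
    (Matrix.of fun i j => (inner ℂ (v i) (v j) : ℂ)).PosSemidef := by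
  refine ⟨?_, fun x => ?_⟩
  · ext i j
    simp
  · have h1 : (0 : ℂ) ≤ inner ℂ (x.sum fun i a => a • v i) (x.sum fun i a => a • v i) := by
      rw [inner_self_eq_norm_sq_to_K]
      have := Complex.zero_le_real.2 (sq_nonneg ‖x.sum fun i a => a • v i‖)
      rwa [Complex.ofReal_pow] at this
    refine h1.trans_eq ?_
    simp only [Finsupp.sum, sum_inner, inner_sum, inner_smul_left, inner_smul_right,
      Matrix.of_apply, RCLike.star_def, Finset.mul_sum]
    rw [Finset.sum_comm]
    refine Finset.sum_congr rfl fun i _ => Finset.sum_congr rfl fun j _ => ?_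
    ring

open scoped ComplexOrder in
theorem tensorKernel_posSemidef (hh : ∀ᶠ n in atTop, ‖h n‖ = 1) :
    (tensorKernel h).PosSemidef := by
  have hN : ∀ N : ℕ, (Matrix.of fun v w : StabSeq h =>
      ∏ n ∈ Finset.range N, inner ℂ (v.1 n) (w.1 n)).PosSemidef := by
    intro N
    induction N with
    | zero =>
      have := gram_posSemidef (fun _ : StabSeq h => (1 : ℂ))
      convert this using 1
      ext v w
      simp
    | succ N ih =>
      have e : (Matrix.of fun v w : StabSeq h =>
          ∏ n ∈ Finset.range (N + 1), (inner ℂ (v.1 n) (w.1 n) : ℂ))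
          = Matrix.hadamard
            (Matrix.of fun v w : StabSeq h => ∏ n ∈ Finset.range N, (inner ℂ (v.1 n) (w.1 n) : ℂ))
            (Matrix.of fun v w : StabSeq h => (inner ℂ (v.1 N) (w.1 N) : ℂ)) := by
        ext v w
        simp [Finset.prod_range_succ]
      rw [e]
      exact ih.hadamard (gram_posSemidef (fun v : StabSeq h => v.1 N))
  refine ⟨?_, fun x => ?_⟩
  · ext v w
    obtain ⟨N, h1, h2⟩ := ((tensorKernel_eventually hh v w).and
      (tensorKernel_eventually hh w v)).exists
    rw [Matrix.conjTranspose_apply, h1, h2]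
    exact congrFun (congrFun (hN N).1 v) w
  · have hev : ∀ᶠ N in atTop, ∀ v ∈ x.support, ∀ w ∈ x.support,
        tensorKernel h v w = ∏ n ∈ Finset.range N, inner ℂ (v.1 n) (w.1 n) := by
      rw [Filter.eventually_all_finset]
      intro v _
      rw [Filter.eventually_all_finset]
      intro w _
      exact tensorKernel_eventually hh v w
    obtain ⟨N, hN'⟩ := hev.exists
    have := (hN N).2 x
    refine this.trans_eq ?_
    refine Finset.sum_congr rfl fun v hv => Finset.sum_congr rfl fun w hw => ?_
    simp only [Matrix.of_apply]
    rw [hN' v hv w hw]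

variable (h)

/-- The inner product of finite linear combinations of simple tensors. -/
def tensorInner (x y : StabSeq h →₀ ℂ) : ℂ :=
  x.sum fun v a => y.sum fun w b => star a * tensorKernel h v w * b

variable {h} in
theorem tensorInner_conj (hh : ∀ᶠ n in atTop, ‖h n‖ = 1) (x y : StabSeq h →₀ ℂ) :
    star (tensorInner h y x) = tensorInner h x y := by
  simp only [tensorInner, Finsupp.sum]
  rw [Finset.sum_comm]
  simp only [star_sum]
  refine Finset.sum_congr rfl fun v _ => Finset.sum_congr rfl fun w _ => ?_
  rw [← (tensorKernel_posSemidef hh).1.apply v w]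
  simp only [star_mul', star_star]
  ring

variable {h} in
open scoped ComplexOrder in
theorem tensorInner_nonneg (hh : ∀ᶠ n in atTop, ‖h n‖ = 1) (x : StabSeq h →₀ ℂ) :
    0 ≤ (tensorInner h x x).re :=
  (Complex.nonneg_iff.1 ((tensorKernel_posSemidef hh).2 x)).1

theorem tensorInner_add (x y z : StabSeq h →₀ ℂ) :
    tensorInner h (x + y) z = tensorInner h x z + tensorInner h y z := by
  refine Finsupp.sum_add_index' (fun v => ?_) fun v a b => ?_
  · simp [Finsupp.sum]
  · simp [add_mul, Finsupp.sum, Finset.sum_add_distrib]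

theorem tensorInner_smul (r : ℂ) (x y : StabSeq h →₀ ℂ) :
    tensorInner h (r • x) y = star r * tensorInner h x y := by
  rw [tensorInner, Finsupp.sum_smul_index (by simp [Finsupp.sum])]
  simp only [tensorInner, Finsupp.sum, Finset.mul_sum, star_mul', mul_assoc]

/-- The pre-inner product on finite linear combinations of simple tensors. -/
@[reducible]
def tensorCore : PreInnerProductSpace.Core ℂ (PreTensor h hh) where
  inner := tensorInner h
  conj_inner_symm := tensorInner_conj hh
  re_inner_nonneg := tensorInner_nonneg hh
  add_left := tensorInner_add h
  smul_left x y r := tensorInner_smul h r x y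

instance : SeminormedAddCommGroup (PreTensor h hh) :=
  InnerProductSpace.Core.toSeminormedAddCommGroup (c := tensorCore h hh)

instance : InnerProductSpace ℂ (PreTensor h hh) := InnerProductSpace.ofCore (tensorCore h hh)

/-- The incomplete tensor product of the Hilbert spaces `H n` determined by the stabilizing
vectors `h n`: the completion of the space of finite linear combinations of simple tensors all but
finitely many of whose factors coincide with the stabilizing vectors. -/
abbrev IncompleteTensor : Type := UniformSpace.Completion (PreTensor h hh)

/-- The simple tensor with factors `v n`. -/
def simpleTensor (v : StabSeq h) : IncompleteTensor h hh :=
  ((show PreTensor h hh from Finsupp.single v (1 : ℂ)) : UniformSpace.Completion (PreTensor h hh))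

end Tensor

open Filter

/-! ### The irreducible Schur-Weyl representations -/

/-- The Young diagram `(k + j, j)`. -/
def lam (k j : ℕ) : ℕ × ℕ := (k + j, j)

section Representation

variable (k : ℕ) (h : ∀ j, PathSpace (lam k j) (lam k (j + 1))) (hh : ∀ j, ‖h j‖ = 1)

/-- The embedding of the space of the representation `π_{(k+j,j)}` of the symmetric group (with the
Young basis, which is indexed by the Young tableaux of shape `(k + j, j)`) into that of
`π_{(k+j+1,j+1)}` determined by the unit vector `h j`. -/
def levelEmbed (j : ℕ) :
    PathSpace (0, 0) (lam k j) →ₗᵢ[ℂ] PathSpace (0, 0) (lam k (j + 1)) := embed (h j) (hh j)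

/-- The space `H_k(h)` of the representation `Π_k(h)`: the inductive limit of the spaces of the
representations `π_{(k+j,j)}`. -/
abbrev Space : Type := HilbertLimit (levelEmbed k h hh)

theorem levelEmbed_youngOp (i : ℕ) : ∀ᶠ j in atTop, ∀ v : PathSpace (0, 0) (lam k j),
    levelEmbed k h hh j (youngOp (0, 0) (lam k j) i v)
      = youngOp (0, 0) (lam k (j + 1)) i (levelEmbed k h hh j v) := by
  filter_upwards [eventually_ge_atTop (i + 2)] with j hj v
  exact embed_youngOp (h j) (hh j) i (by simp [lam]; omega) v

/-- The action in `H_k(h)` of the Coxeter transposition of `i` and `i + 1`: it is given by Young's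
orthogonal form at each level. -/
def coxeterMap (i : ℕ) : Space k h hh →ₗᵢ[ℂ] Space k h hh :=
  limitMap (φ := levelEmbed k h hh) (fun j => youngOp (0, 0) (lam k j) i)
    (levelEmbed_youngOp k h hh i)

theorem coxeterMap_coe (i : ℕ) (v : PreLimit (levelEmbed k h hh)) :
    ∃ v' : PreLimit (levelEmbed k h hh), coxeterMap k h hh i (v : Space k h hh) = v' ∧
      ∀ j, v'.seq j = youngOp (0, 0) (lam k j) i (v.seq j) :=
  ⟨_, limitMap_coe _ _ v, fun _ => rfl⟩

theorem coxeterMap_involutive (i : ℕ) : Function.Involutive (coxeterMap k h hh i) := by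
  have : (coxeterMap k h hh i).comp (coxeterMap k h hh i) = LinearIsometry.id := by
    refine limit_ext fun v => ?_
    obtain ⟨v1, h1, e1⟩ := coxeterMap_coe k h hh i v
    obtain ⟨v2, h2, e2⟩ := coxeterMap_coe k h hh i v1
    change coxeterMap k h hh i (coxeterMap k h hh i v) = v
    rw [h1, h2]
    refine coe_eq_of_eventually (Eventually.of_forall fun j => ?_)
    rw [e2, e1]
    apply coeff_injective
    rw [coeff_youngOp, coeff_youngOp, youngFun_sq i (supp_coeff _)]
  exact fun x => DFunLike.congr_fun this x

/-- The unitary operator defined by `coxeterMap`. -/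
def coxeterOp (i : ℕ) : Space k h hh ≃ₗᵢ[ℂ] Space k h hh where
  toLinearEquiv := LinearEquiv.ofInvolutive (coxeterMap k h hh i).toLinearMap
    (coxeterMap_involutive k h hh i)
  norm_map' := (coxeterMap k h hh i).norm_map

theorem coxeterOp_rel : CoxeterRel (coxeterOp k h hh) where
  sq i := by
    ext x
    exact coxeterMap_involutive k h hh i x
  comm i i' hi := by
    have : (coxeterMap k h hh i).comp (coxeterMap k h hh i')
        = (coxeterMap k h hh i').comp (coxeterMap k h hh i) := by
      refine limit_ext fun v => ?_
      obtain ⟨v1, h1, e1⟩ := coxeterMap_coe k h hh i' v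
      obtain ⟨v2, h2, e2⟩ := coxeterMap_coe k h hh i v1
      obtain ⟨w1, h3, e3⟩ := coxeterMap_coe k h hh i v
      obtain ⟨w2, h4, e4⟩ := coxeterMap_coe k h hh i' w1
      change coxeterMap k h hh i (coxeterMap k h hh i' v)
        = coxeterMap k h hh i' (coxeterMap k h hh i v)
      rw [h1, h2, h3, h4]
      refine coe_eq_of_eventually (Eventually.of_forall fun j => ?_)
      rw [e2, e1, e4, e3]
      apply coeff_injective
      simp only [coeff_youngOp]
      exact youngFun_comm _ hi _
    ext x
    exact DFunLike.congr_fun this x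
  braid i := by
    have : ((coxeterMap k h hh i).comp (coxeterMap k h hh (i + 1))).comp (coxeterMap k h hh i)
        = ((coxeterMap k h hh (i + 1)).comp (coxeterMap k h hh i)).comp
          (coxeterMap k h hh (i + 1)) := by
      refine limit_ext fun v => ?_
      obtain ⟨v1, h1, e1⟩ := coxeterMap_coe k h hh i v
      obtain ⟨v2, h2, e2⟩ := coxeterMap_coe k h hh (i + 1) v1
      obtain ⟨v3, h3, e3⟩ := coxeterMap_coe k h hh i v2
      obtain ⟨w1, h4, e4⟩ := coxeterMap_coe k h hh (i + 1) v
      obtain ⟨w2, h5, e5⟩ := coxeterMap_coe k h hh i w1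
      obtain ⟨w3, h6, e6⟩ := coxeterMap_coe k h hh (i + 1) w2
      change coxeterMap k h hh i (coxeterMap k h hh (i + 1) (coxeterMap k h hh i v))
        = coxeterMap k h hh (i + 1) (coxeterMap k h hh i (coxeterMap k h hh (i + 1) v))
      rw [h1, h2, h3, h4, h5, h6]
      refine coe_eq_of_eventually ?_
      filter_upwards [eventually_ge_atTop (i + 3)] with j hj
      rw [e3, e2, e1, e6, e5, e4]
      apply coeff_injective
      simp only [coeff_youngOp]
      exact youngFun_braid i (by simp [lam]; omega) (supp_coeff _)
    ext x
    exact DFunLike.congr_fun this x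

/-- The unitary representation `Π_k(h)` of the infinite symmetric group. -/
def rep : InfSym →* (Space k h hh ≃ₗᵢ[ℂ] Space k h hh) :=
  liftCoxeter (coxeterOp k h hh) (coxeterOp_rel k h hh)

end Representation

/-! ### The decomposition -/

/-- The pair of diagrams is nice: the second is obtained from the first by adding one cell to each
row. -/
def IsNice (p q : ℕ × ℕ) : Prop := q = (p.1 + 1, p.2 + 1)

/-- The restrictions of two-row Young tableaux (regarded as sequences of Young diagrams) to the
odd levels (`ε = 1`) or to the even levels (`ε = 0`) such that all but finitely many pairs of
successive diagrams are nice. The diagram `τ i` has `ε + 2 * i` cells. -/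
def restrictedTableaux (ε : ℕ) : Set (ℕ → ℕ × ℕ) :=
  {τ | (∀ i, IsDiagram (τ i) ∧ (τ i).1 + (τ i).2 = ε + 2 * i ∧ τ i ≤ τ (i + 1)) ∧
    ∀ᶠ i in atTop, IsNice (τ i) (τ (i + 1))}

/-- The elements of `restrictedTableaux` for which the difference of the lengths of the rows
stabilizes to `k`; the levels are those of the parity of `k`. -/
def tailClass (k : ℕ) : Set (ℕ → ℕ × ℕ) :=
  {τ ∈ restrictedTableaux (k % 2) | ∀ᶠ i in atTop, ((τ i).1 : ℤ) - (τ i).2 = k}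

theorem tailClass_eventually {k : ℕ} {τ : ℕ → ℕ × ℕ} (hτ : τ ∈ tailClass k) :
    ∀ᶠ i in atTop, τ i = lam k (i - k / 2) := by
  filter_upwards [hτ.2, eventually_ge_atTop k] with i h1 h2
  have h3 := (hτ.1.1 i).2.1
  apply Prod.ext <;> simp only [lam] <;> omega

section Decomposition

variable (k : ℕ) (h : ∀ j, PathSpace (lam k j) (lam k (j + 1)))

/-- The stabilizing vectors: for sufficiently large `i` the diagrams `τ i` and `τ (i + 1)` are
`(k + j, j)` and `(k + j + 1, j + 1)` with `j = i - k / 2`, and the stabilizing vector is `h j`.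
(The finitely many other members of the sequence are irrelevant.) -/
def stab (τ : ℕ → ℕ × ℕ) (i : ℕ) : PathSpace (τ i) (τ (i + 1)) :=
  ofCoeff _ _ (coeff (h (i - k / 2)))

variable {k h}

theorem stab_norm (hh : ∀ j, ‖h j‖ = 1) {τ : ℕ → ℕ × ℕ} (hτ : τ ∈ tailClass k) :
    ∀ᶠ i in atTop, ‖stab k h τ i‖ = 1 := by
  have aux : ∀ (p q p' q' : ℕ × ℕ) (v : PathSpace p q), p' = p → q' = q →
      ‖ofCoeff p' q' (coeff v)‖ = ‖v‖ := by
    rintro p q _ _ v rfl rfl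
    congr 1
    exact coeff_injective (coeff_ofCoeff (supp_coeff v))
  have h1 := tailClass_eventually hτ
  filter_upwards [h1, (tendsto_add_atTop_nat 1).eventually h1, eventually_ge_atTop k]
    with i h2 h3 h4
  rw [stab, aux _ _ _ _ _ h2 (by rw [h3]; congr 1; omega), hh]

variable (k h)

/-- The incomplete tensor product of the spaces `H(τ i, τ (i + 1))` determined by `h`. -/
abbrev TensorSpace (hh : ∀ j, ‖h j‖ = 1) (τ : tailClass k) : Type :=
  IncompleteTensor (stab k h τ.1) (stab_norm hh τ.2)

variable {k h}

/-- A simple tensor regarded as a vector at the level `k + 2 * j`, that is, as a function on the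
Young tableaux of shape `(k + j, j)`: its value at a tableau is the product, over the successive
pairs of levels of the parity of `k`, of the coordinates of the factors at the corresponding
segments of the tableau. -/
def tensorAtLevel {τ : ℕ → ℕ × ℕ} (v : ∀ i, PathSpace (τ i) (τ (i + 1))) (j : ℕ) :
    PathSpace (0, 0) (lam k j) :=
  ofCoeff _ _ fun w => ∏ i ∈ Finset.range (k / 2 + j), coeff (v i) ((w.drop (k % 2 + 2 * i)).take 2)

end Decomposition

end SchurWeyl
end

noncomputable section

namespace SchurWeyl

open Filter

/-! ### Isometries defined on completions and on incomplete tensor products -/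

/-! Cutting a path from the empty diagram to `lam k j` at the levels of the parity of `k` records a
chain of diagrams together with the two-cell segments joining them. Thus the basis of the level-`j`
space is partitioned by chains. The basis paths with a given chain span the tensor product of the
spaces of segments, because concatenation multiplies inner products (`inner_concat`). The empty
diagram or the single cell at the start contributes exactly one path, hence a factor `1`.

The embeddings of the inductive limit append `h j`, and so do the stabilizing vectors of the
incomplete tensor product. A simple tensor therefore gives an eventually coherent sequence
(`levelEmbed_tensorAtLevel`). Its inner products are eventually the products of those of the factors
(`inner_tensorPreLimit`). This equality of Gram kernels is all that `tensorLift` needs to produce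
the isometry `tensorEmbed`.

Different chains give vectors supported on disjoint sets of paths at high levels, so the ranges are
orthogonal (`inner_tensorEmbed_of_ne`). They are total because each basis path of each level is
itself a simple tensor: its factors are its own segments, continued by the `h j`
(`tensorEmbed_pathFactors`). Images of the levels are dense in the limit.

Non-invariance comes from a Coxeter transposition straddling two successive segments. If `t` ends at
`lam k j` with `j` large, exchanging the middle cells of `t ++ [0, 1, 0, 1]` gives `t ++ [0, 0, 1,
1]`, which has another chain. The matrix entry of Young's orthogonal form between the two is `√(1 -
(k + 2)⁻²)`, which is positive, so the image has a nonzero component outside the original summand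
(`exists_rep_notMem_range`). -/

/-- The extension to the completion of an isometry to a complete space. -/
def completionExtend {V K : Type} [SeminormedAddCommGroup V] [InnerProductSpace ℂ V]
    [NormedAddCommGroup K] [InnerProductSpace ℂ K] [CompleteSpace K] (f : V →ₗᵢ[ℂ] K) :
    UniformSpace.Completion V →ₗᵢ[ℂ] K where
  toFun := UniformSpace.Completion.extension f
  map_add' := by
    have hu := f.isometry.uniformContinuous
    have hc : Continuous (UniformSpace.Completion.extension f) :=
      UniformSpace.Completion.continuous_extension
    intro u v
    induction u, v using UniformSpace.Completion.induction_on₂ with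
    | hp =>
      exact isClosed_eq (hc.comp continuous_add)
        ((hc.comp continuous_fst).add (hc.comp continuous_snd))
    | ih u v =>
      rw [← UniformSpace.Completion.coe_add, UniformSpace.Completion.extension_coe hu,
        UniformSpace.Completion.extension_coe hu, UniformSpace.Completion.extension_coe hu, map_add]
  map_smul' := by
    have hu := f.isometry.uniformContinuous
    have hc : Continuous (UniformSpace.Completion.extension f) :=
      UniformSpace.Completion.continuous_extension
    intro c v
    induction v using UniformSpace.Completion.induction_on with
    | hp => exact isClosed_eq (hc.comp (continuous_const_smul c)) (hc.const_smul c)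
    | ih v =>
      rw [← UniformSpace.Completion.coe_smul, UniformSpace.Completion.extension_coe hu,
        UniformSpace.Completion.extension_coe hu, map_smul]
      rfl
  norm_map' := by
    have hu := f.isometry.uniformContinuous
    have hc : Continuous (UniformSpace.Completion.extension f) :=
      UniformSpace.Completion.continuous_extension
    intro v
    induction v using UniformSpace.Completion.induction_on with
    | hp => exact isClosed_eq hc.norm continuous_norm
    | ih v =>
      change ‖UniformSpace.Completion.extension f (v : UniformSpace.Completion V)‖ = _
      rw [UniformSpace.Completion.extension_coe hu, UniformSpace.Completion.norm_coe,
        LinearIsometry.norm_map]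

theorem completionExtend_coe {V K : Type} [SeminormedAddCommGroup V] [InnerProductSpace ℂ V]
    [NormedAddCommGroup K] [InnerProductSpace ℂ K] [CompleteSpace K] (f : V →ₗᵢ[ℂ] K) (v : V) :
    completionExtend f (v : UniformSpace.Completion V) = f v :=
  UniformSpace.Completion.extension_coe f.isometry.uniformContinuous v

section Tensor

variable {H : ℕ → Type} [∀ n, NormedAddCommGroup (H n)] [∀ n, InnerProductSpace ℂ (H n)]
  {K : Type} [NormedAddCommGroup K] [InnerProductSpace ℂ K] {h : ∀ n, H n}

/-- Both sides are sesquilinear, so agreement on pairs of simple tensors suffices. Multilinearity of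
`f` need not be checked: the multilinear relations among formal tensors have seminorm zero and
disappear in the completion. -/
theorem inner_linearCombination (f : StabSeq h → K)
    (hf : ∀ v w, inner ℂ (f v) (f w) = tensorKernel h v w) (x y : StabSeq h →₀ ℂ) :
    inner ℂ (Finsupp.linearCombination ℂ f x) (Finsupp.linearCombination ℂ f y)
      = tensorInner h x y := by
  simp only [Finsupp.linearCombination_apply, Finsupp.sum, tensorInner, sum_inner, inner_sum,
    inner_smul_left, inner_smul_right, hf]
  rw [Finset.sum_comm]
  refine Finset.sum_congr rfl fun v _ => ?_
  rw [Finset.mul_sum]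
  refine Finset.sum_congr rfl fun w _ => ?_
  rw [RCLike.star_def]
  ring

variable [CompleteSpace K] (hh : ∀ᶠ n in atTop, ‖h n‖ = 1)

/-- The isometry of the incomplete tensor product that has given values with the right inner
products at the simple tensors. -/
def tensorLift (f : StabSeq h → K) (hf : ∀ v w, inner ℂ (f v) (f w) = tensorKernel h v w) :
    IncompleteTensor h hh →ₗᵢ[ℂ] K :=
  completionExtend (LinearMap.isometryOfInner
    (show PreTensor h hh →ₗ[ℂ] K from Finsupp.linearCombination ℂ f)
    (inner_linearCombination f hf))

theorem tensorLift_simpleTensor (f : StabSeq h → K)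
    (hf : ∀ v w, inner ℂ (f v) (f w) = tensorKernel h v w) (v : StabSeq h) :
    tensorLift hh f hf (simpleTensor h hh v) = f v := by
  refine (completionExtend_coe _ _).trans ?_
  exact (Finsupp.linearCombination_single ℂ (1 : ℂ) v).trans (one_smul _ _)

/-- Finite combinations of simple tensors are dense by construction, so a closed linear condition
need only be tested on simple tensors. This serves for the orthogonality of the ranges. -/
theorem simpleTensor_induction {P : IncompleteTensor h hh → Prop}
    (hclosed : IsClosed {x | P x}) (zero : P 0) (add : ∀ x y, P x → P y → P (x + y))
    (smul : ∀ (c : ℂ) x, P x → P (c • x)) (simple : ∀ v, P (simpleTensor h hh v))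
    (x : IncompleteTensor h hh) : P x := by
  induction x using UniformSpace.Completion.induction_on with
  | hp => exact hclosed
  | ih x =>
    refine Finsupp.induction_linear (motive := fun x : StabSeq h →₀ ℂ =>
      P (((show PreTensor h hh from x) : PreTensor h hh) : UniformSpace.Completion _))
      x zero (fun x y hx hy => ?_) fun v c => ?_
    · have := add _ _ hx hy
      rwa [← UniformSpace.Completion.coe_add] at this
    -- The map `e` is the identity, changing only the type: a formal tensor with coefficient `c` is
    -- `c` times the one with coefficient `1`, now read in the seminormed space.
    · let e : (StabSeq h →₀ ℂ) → PreTensor h hh := fun x => x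
      have h1 : c • e (Finsupp.single v 1) = e (Finsupp.single v c) :=
        (Finsupp.smul_single c v (1 : ℂ)).trans (by rw [smul_eq_mul, mul_one])
      have h2 : c • simpleTensor h hh v
          = ((e (Finsupp.single v c) : PreTensor h hh) : UniformSpace.Completion _) := by
        rw [← h1]
        exact (UniformSpace.Completion.coe_smul c _).symm
      have h3 := smul c _ (simple v)
      rwa [h2] at h3

end Tensor

/-! ### Vectors of the inductive limit -/

section Limit

variable {E : ℕ → Type} [∀ j, NormedAddCommGroup (E j)] [∀ j, InnerProductSpace ℂ (E j)]
  {φ : ∀ j, E j →ₗᵢ[ℂ] E (j + 1)}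

/-- From level `j` on, a coherent sequence is determined by its member at `j`. Earlier members do
not matter, since sequences that eventually coincide are identified. -/
theorem coe_eq_of_coherent {u v : PreLimit φ} (j : ℕ)
    (hu : ∀ i, j ≤ i → u.seq (i + 1) = φ i (u.seq i))
    (hv : ∀ i, j ≤ i → v.seq (i + 1) = φ i (v.seq i)) (h : u.seq j = v.seq j) :
    (u : HilbertLimit φ) = (v : HilbertLimit φ) := by
  refine coe_eq_of_eventually ?_
  filter_upwards [eventually_ge_atTop j] with i hi
  induction i, hi using Nat.le_induction with
  | base => exact h
  | succ i hi ih => rw [hu i hi, hv i hi, ih]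

theorem fromLevel_self (j : ℕ) (v : E j) : fromLevel φ j v j = v := by
  -- Below level `j` the sequence vanishes, so at level `j` the recursive summand is `φ` of zero and
  -- only the inserted vector remains.
  have h0 : ∀ i, i < j → fromLevel φ j v i = 0 := by
    intro i hi
    induction i with
    | zero => rw [fromLevel, Pi.single_eq_of_ne (by omega)]
    | succ i ih => rw [fromLevel, Pi.single_eq_of_ne (by omega), ih (by omega), map_zero, add_zero]
  cases j with
  | zero => exact Pi.single_eq_same _ _
  | succ j => rw [fromLevel, h0 j (by omega), map_zero, add_zero, Pi.single_eq_same]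

theorem fromLevel_succ {j : ℕ} (v : E j) (i : ℕ) (hi : j ≤ i) :
    fromLevel φ j v (i + 1) = φ i (fromLevel φ j v i) := by
  rw [fromLevel, Pi.single_eq_of_ne (by omega), zero_add]

/-- Every vector of the algebraic limit comes from a single finite level. Both the formula on simple
tensors and the density argument depend on this. -/
theorem toLimit_eq_coe {u : PreLimit φ} (j : ℕ)
    (hu : ∀ i, j ≤ i → u.seq (i + 1) = φ i (u.seq i)) :
    toLimit φ j (u.seq j) = (u : HilbertLimit φ) :=
  coe_eq_of_coherent j (fromLevel_succ _) hu (fromLevel_self j _)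

theorem toLimit_add (j : ℕ) (u v : E j) :
    toLimit φ j (u + v) = toLimit φ j u + toLimit φ j v := by
  rw [toLimit, toLimit, toLimit, ← UniformSpace.Completion.coe_add]
  refine coe_eq_of_coherent j (fromLevel_succ _) (fun i hi => ?_) ?_
  · change fromLevel φ j u (i + 1) + fromLevel φ j v (i + 1)
      = φ i (fromLevel φ j u i + fromLevel φ j v i)
    rw [fromLevel_succ u i hi, fromLevel_succ v i hi, map_add]
  · change fromLevel φ j (u + v) j = fromLevel φ j u j + fromLevel φ j v j
    simp only [fromLevel_self]

theorem toLimit_smul (j : ℕ) (c : ℂ) (v : E j) :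
    toLimit φ j (c • v) = c • toLimit φ j v := by
  rw [toLimit, toLimit, ← UniformSpace.Completion.coe_smul]
  refine coe_eq_of_coherent j (fromLevel_succ _) (fun i hi => ?_) ?_
  · change c • fromLevel φ j v (i + 1) = φ i (c • fromLevel φ j v i)
    rw [fromLevel_succ v i hi, map_smul]
  · change fromLevel φ j (c • v) j = c • fromLevel φ j v j
    simp only [fromLevel_self]

/-- The canonical map of `E j` to the inductive limit as a linear map. -/
def toLimitLinear (φ : ∀ j, E j →ₗᵢ[ℂ] E (j + 1)) (j : ℕ) : E j →ₗ[ℂ] HilbertLimit φ where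
  toFun := toLimit φ j
  map_add' := toLimit_add j
  map_smul' := toLimit_smul j

theorem inner_coe_of_eventually {u v : PreLimit φ} {c : ℂ}
    (h : ∀ᶠ j in atTop, inner ℂ (u.seq j) (v.seq j) = c) :
    inner ℂ (u : HilbertLimit φ) (v : HilbertLimit φ) = c := by
  rw [UniformSpace.Completion.inner_coe, preLimit_inner]
  obtain ⟨j, h1, h2⟩ := (h.and (limitInner_eventually φ u v)).exists
  rw [h2, h1]

theorem inner_toLimit (j : ℕ) (u v : E j) :
    inner ℂ (toLimit φ j u) (toLimit φ j v) = inner ℂ u v := by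
  refine inner_coe_of_eventually ?_
  filter_upwards [eventually_ge_atTop j] with i hi
  change inner ℂ (fromLevel φ j u i) (fromLevel φ j v i) = _
  induction i, hi using Nat.le_induction with
  | base => rw [fromLevel_self, fromLevel_self]
  | succ i hi ih => rw [fromLevel_succ u i hi, fromLevel_succ v i hi, LinearIsometry.inner_map_map, ih]

/-- An eventually coherent sequence is the image of its member at any level past which it is
coherent, so the images of the levels are dense. -/
theorem limit_mem_of_toLimit_mem (S : Submodule ℂ (HilbertLimit φ))
    (hS : IsClosed (S : Set (HilbertLimit φ)))
    (h : ∀ j v, toLimit φ j v ∈ S) (x : HilbertLimit φ) : x ∈ S := by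
  induction x using UniformSpace.Completion.induction_on with
  | hp => exact hS
  | ih u =>
    obtain ⟨j, hj⟩ := eventually_atTop.1 u.eventually
    rw [← toLimit_eq_coe j hj]
    exact h j _

/-- Compatibility from level `j` on, not merely eventually, allows the limit operator to be computed
at level `j` itself. -/
theorem limitMap_toLimit (T : ∀ j, E j →ₗᵢ[ℂ] E j)
    (hT : ∀ᶠ j in atTop, ∀ v, φ j (T j v) = T (j + 1) (φ j v)) (j : ℕ)
    (hj : ∀ i, j ≤ i → ∀ v, φ i (T i v) = T (i + 1) (φ i v)) (v : E j) :
    limitMap T hT (toLimit φ j v) = toLimit φ j (T j v) := by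
  refine (limitMap_coe T hT _).trans ?_
  refine coe_eq_of_coherent j (fun i hi => ?_) (fromLevel_succ _) ?_
  · change T (i + 1) (fromLevel φ j v (i + 1)) = φ i (T i (fromLevel φ j v i))
    rw [fromLevel_succ v i hi, hj i hi]
  · change T j (fromLevel φ j v j) = fromLevel φ j (T j v) j
    rw [fromLevel_self, fromLevel_self]

end Limit


/-! ### Segments of paths -/

/-- The diagram reached from `p` by the word `w`. -/
def endpoint (p : ℕ × ℕ) (w : List (Fin 2)) : ℕ × ℕ := w.foldl addCell p

theorem endpoint_append (p : ℕ × ℕ) (v w : List (Fin 2)) :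
    endpoint p (v ++ w) = endpoint (endpoint p v) w := List.foldl_append

theorem endpoint_size (p : ℕ × ℕ) (w : List (Fin 2)) :
    (endpoint p w).1 + (endpoint p w).2 = p.1 + p.2 + w.length := by
  induction w generalizing p with
  | nil => simp [endpoint]
  | cons a w ih =>
    have := ih (addCell p a)
    rw [addCell_size] at this
    rw [List.length_cons]
    exact this.trans (by omega)

theorem le_endpoint (p : ℕ × ℕ) (w : List (Fin 2)) : p ≤ endpoint p w := by
  induction w generalizing p with
  | nil => exact le_rfl
  | cons a w ih =>
    refine le_trans ?_ (ih (addCell p a))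
    fin_cases a <;> simp [addCell, Prod.le_def]

theorem IsPath.endpoint_eq {p q : ℕ × ℕ} {w : List (Fin 2)} (h : IsPath p w q) :
    endpoint p w = q := by
  induction w generalizing p with
  | nil => exact h.2
  | cons a w ih => exact ih h.2

theorem IsPath.take {p q : ℕ × ℕ} {w : List (Fin 2)} (h : IsPath p w q) (n : ℕ) :
    IsPath p (w.take n) (endpoint p (w.take n)) := by
  induction n generalizing p w with
  | zero => exact ⟨h.isDiagram, rfl⟩
  | succ n ih =>
    cases w with
    | nil => exact ⟨h.isDiagram, rfl⟩
    | cons a w => exact ⟨h.1, ih h.2⟩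

theorem IsPath.drop {p q : ℕ × ℕ} {w : List (Fin 2)} (h : IsPath p w q) (n : ℕ) :
    IsPath (endpoint p (w.take n)) (w.drop n) q := by
  induction n generalizing p w with
  | zero => exact h
  | succ n ih =>
    cases w with
    | nil => exact h
    | cons a w => exact ih h.2

theorem IsPath.isDiagram_right {p q : ℕ × ℕ} {w : List (Fin 2)} (h : IsPath p w q) :
    IsDiagram q := by
  induction w generalizing p with
  | nil => exact h.2 ▸ h.1
  | cons a w ih => exact ih h.2

theorem IsPath.segment {p q : ℕ × ℕ} {w : List (Fin 2)} (h : IsPath p w q) (m n : ℕ) :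
    IsPath (endpoint p (w.take m)) ((w.drop m).take n) (endpoint p (w.take (m + n))) := by
  have h1 := (h.drop m).take n
  rwa [← endpoint_append, ← List.take_add] at h1

theorem isPath_of_size_le_one {p : ℕ × ℕ} (hp : IsDiagram p) {ε : ℕ} (hε : ε ≤ 1)
    (hs : p.1 + p.2 = ε) : IsPath (0, 0) (List.replicate ε 0) p := by
  unfold IsDiagram at hp
  obtain ⟨a, b⟩ := p
  simp only at hs hp
  interval_cases ε
  · obtain ⟨rfl, rfl⟩ : a = 0 ∧ b = 0 := by omega
    simp [IsPath, IsDiagram]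
  · obtain ⟨rfl, rfl⟩ : a = 1 ∧ b = 0 := by omega
    simp [IsPath, IsDiagram, addCell]

/-- The first cell of a path from the empty diagram must go into the first row, so the prefix of
length `ε ≤ 1` carries no information. -/
theorem IsPath.take_parity {q : ℕ × ℕ} {w : List (Fin 2)} (h : IsPath (0, 0) w q) {ε : ℕ}
    (hε : ε ≤ 1) (hw : ε ≤ w.length) : w.take ε = List.replicate ε 0 := by
  interval_cases ε
  · rfl
  · rcases w with _ | ⟨a, w⟩
    · simp at hw
    · have := h.2.isDiagram
      fin_cases a
      · rfl
      · simp [addCell, IsDiagram] at this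

/-! ### Concatenation of the factors of a simple tensor -/

section Concat

variable {τ : ℕ → ℕ × ℕ}

/-- The concatenation of the first `n` factors of a simple tensor, prefixed by the paths from the
empty diagram to `τ 0`. -/
def tensorUpTo (v : ∀ i, PathSpace (τ i) (τ (i + 1))) : ∀ n, PathSpace (0, 0) (τ n)
  -- Since `τ 0` has at most one cell in the application, there is exactly one path to it, and the
  -- constant function `1` is that basis vector.
  | 0 => ofCoeff _ _ fun _ => 1
  | n + 1 => concat (tensorUpTo v n) (v n)

variable {ε : ℕ}

theorem coeff_tensorUpTo (hs : ∀ i, (τ i).1 + (τ i).2 = ε + 2 * i)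
    (v : ∀ i, PathSpace (τ i) (τ (i + 1))) (n : ℕ) {w : List (Fin 2)}
    (hw : w.length = ε + 2 * n) (hp : IsPath (0, 0) (w.take ε) (τ 0)) :
    coeff (tensorUpTo v n) w
      = ∏ i ∈ Finset.range n, coeff (v i) ((w.drop (ε + 2 * i)).take 2) := by
  induction n generalizing w with
  | zero =>
    rw [List.take_of_length_le (by omega)] at hp
    simp [tensorUpTo, coeff, ofCoeff, hp]
  | succ n ih =>
    have hn := hs n
    rw [tensorUpTo, coeff_concat, Finset.prod_range_succ, hn, Nat.add_zero, Nat.sub_zero,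
      ih (by rw [List.length_take]; omega) (by rwa [List.take_take, min_eq_left (by omega)])]
    congr 1
    · refine Finset.prod_congr rfl fun i hi => ?_
      have := Finset.mem_range.1 hi
      rw [List.drop_take, List.take_take, min_eq_left (by omega)]
    · rw [List.take_of_length_le (by rw [List.length_drop]; omega)]

/-- Each factor is supported on paths from `τ i` to `τ (i + 1)`, so a word in the support of the
concatenation passes through every `τ i`. The chain can thus be recovered from any word in the
support, which is the source of orthogonality. -/
theorem endpoint_of_coeff_tensorUpTo_ne_zero (hs : ∀ i, (τ i).1 + (τ i).2 = ε + 2 * i)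
    (v : ∀ i, PathSpace (τ i) (τ (i + 1))) {n : ℕ} {w : List (Fin 2)}
    (hw : coeff (tensorUpTo v n) w ≠ 0) {i : ℕ} (hi : i ≤ n) :
    endpoint (0, 0) (w.take (ε + 2 * i)) = τ i := by
  have hpath : IsPath (0, 0) w (τ n) := by
    by_contra h
    exact hw (supp_coeff _ _ h)
  induction n generalizing w with
  | zero =>
    obtain rfl : i = 0 := by omega
    have := hpath.length
    rw [List.take_of_length_le (by have := hs 0; simp at this ⊢; omega)]
    exact hpath.endpoint_eq
  | succ n ih =>
    have hn := hs n
    rcases Nat.lt_or_ge n i with h1 | h1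
    · obtain rfl : i = n + 1 := by omega
      have := hpath.length
      rw [List.take_of_length_le (by have := hs (n + 1); simp at this ⊢; omega)]
      exact hpath.endpoint_eq
    · rw [tensorUpTo, coeff_concat, hn, Nat.add_zero, Nat.sub_zero] at hw
      have h2 := left_ne_zero_of_mul hw
      have h3 := ih h2 h1 (by by_contra h; exact h2 (supp_coeff _ _ h))
      rwa [List.take_take, min_eq_left (by omega)] at h3

/-- Concatenation multiplies inner products. The base case uses the uniqueness of the path to `τ 0`,
which makes the initial vector a unit vector. -/
theorem inner_tensorUpTo (h0 : IsDiagram (τ 0)) (hε : ε ≤ 1)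
    (hs : ∀ i, (τ i).1 + (τ i).2 = ε + 2 * i)
    (v w : ∀ i, PathSpace (τ i) (τ (i + 1))) (n : ℕ) :
    inner ℂ (tensorUpTo v n) (tensorUpTo w n) = ∏ i ∈ Finset.range n, inner ℂ (v i) (w i) := by
  induction n with
  | zero =>
    have hc : Fintype.card (YoungPath (0, 0) (τ 0)) = 1 := by
      have h1 := hs 0
      refine Fintype.card_eq_one_iff.2
        ⟨⟨_, isPath_of_size_le_one h0 hε (by omega)⟩, fun t => Subtype.ext ?_⟩
      have := t.2.length
      have h2 := t.2.take_parity hε (by simp at this; omega)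
      rwa [List.take_of_length_le (by simp at this; omega)] at h2
    simp only [tensorUpTo, ofCoeff, PiLp.inner_apply]
    simp [hc]
  | succ n ih => rw [tensorUpTo, tensorUpTo, inner_concat, ih, Finset.prod_range_succ]

end Concat

/-! ### Simple tensors at the levels of the inductive limit -/

section Levels

variable {k : ℕ} {τ : ℕ → ℕ × ℕ}

theorem tailClass_size (hτ : τ ∈ tailClass k) (i : ℕ) :
    (τ i).1 + (τ i).2 = k % 2 + 2 * i := (hτ.1.1 i).2.1

theorem parity_le_one (k : ℕ) : k % 2 ≤ 1 := Nat.le_of_lt_succ (Nat.mod_lt k two_pos)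

theorem IsPath.length_lam {j : ℕ} {w : List (Fin 2)} (hw : IsPath (0, 0) w (lam k j)) :
    w.length = k % 2 + 2 * (k / 2 + j) := by
  have := hw.length
  simp only [lam] at this
  omega

theorem coeff_tensorAtLevel_of_isPath (v : ∀ i, PathSpace (τ i) (τ (i + 1))) {j : ℕ}
    {w : List (Fin 2)} (hw : IsPath (0, 0) w (lam k j)) :
    coeff (tensorAtLevel (k := k) v j) w
      = ∏ i ∈ Finset.range (k / 2 + j), coeff (v i) ((w.drop (k % 2 + 2 * i)).take 2) := by
  rw [coeff, dif_pos hw]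
  rfl

/-- Links the product formula with iterated concatenation. The two vectors live in spaces whose
endpoints are equal only by `hj`, so they are compared through their coefficient functions on words.
-/
theorem coeff_tensorAtLevel (hτ : τ ∈ tailClass k) (v : ∀ i, PathSpace (τ i) (τ (i + 1))) {j : ℕ}
    (hj : τ (k / 2 + j) = lam k j) :
    coeff (tensorAtLevel (k := k) v j) = coeff (tensorUpTo v (k / 2 + j)) := by
  ext w
  by_cases hw : IsPath (0, 0) w (lam k j)
  · have hl := hw.length_lam
    rw [coeff_tensorAtLevel_of_isPath v hw, coeff_tensorUpTo (tailClass_size hτ) v _ hl]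
    rw [hw.take_parity (parity_le_one k) (by omega)]
    exact isPath_of_size_le_one (hτ.1.1 0).1 (parity_le_one k) (tailClass_size hτ 0)
  · rw [supp_coeff _ _ hw, supp_coeff _ _ (by rwa [hj])]

theorem inner_tensorAtLevel (hτ : τ ∈ tailClass k) (v w : ∀ i, PathSpace (τ i) (τ (i + 1)))
    {j : ℕ} (hj : τ (k / 2 + j) = lam k j) :
    inner ℂ (tensorAtLevel (k := k) v j) (tensorAtLevel (k := k) w j)
      = ∏ i ∈ Finset.range (k / 2 + j), inner ℂ (v i) (w i) := by
  rw [← inner_tensorUpTo (hτ.1.1 0).1 (parity_le_one k) (tailClass_size hτ), inner_eq_finsum,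
    inner_eq_finsum, coeff_tensorAtLevel hτ v hj, coeff_tensorAtLevel hτ w hj]

/-- A word in both supports would pass through both `τ i` and `τ' i` at the same level. -/
theorem inner_tensorAtLevel_of_ne {τ' : ℕ → ℕ × ℕ} (hτ : τ ∈ tailClass k) (hτ' : τ' ∈ tailClass k)
    (v : ∀ i, PathSpace (τ i) (τ (i + 1))) (w : ∀ i, PathSpace (τ' i) (τ' (i + 1)))
    {i j : ℕ} (hi : i ≤ k / 2 + j) (hne : τ i ≠ τ' i) (hj : τ (k / 2 + j) = lam k j)
    (hj' : τ' (k / 2 + j) = lam k j) :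
    inner ℂ (tensorAtLevel (k := k) v j) (tensorAtLevel (k := k) w j) = 0 := by
  rw [inner_eq_finsum, coeff_tensorAtLevel hτ v hj, coeff_tensorAtLevel hτ' w hj']
  refine finsum_eq_zero_of_forall_eq_zero fun u => ?_
  by_contra h
  obtain ⟨h1, h2⟩ := mul_ne_zero_iff.1 h
  rw [star_ne_zero] at h2
  exact hne ((endpoint_of_coeff_tensorUpTo_ne_zero (tailClass_size hτ) v h2 hi).symm.trans
    (endpoint_of_coeff_tensorUpTo_ne_zero (tailClass_size hτ') w h1 hi))

variable {h : ∀ j, PathSpace (lam k j) (lam k (j + 1))} (hh : ∀ j, ‖h j‖ = 1)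

theorem coeff_stab {j : ℕ} (hj : τ (k / 2 + j) = lam k j)
    (hj' : τ (k / 2 + j + 1) = lam k (j + 1)) : coeff (stab k h τ (k / 2 + j)) = coeff (h j) := by
  rw [stab, Nat.add_sub_cancel_left]
  refine coeff_ofCoeff ?_
  rw [hj, hj']
  exact supp_coeff _

/-- Passing to the next level appends `h j` on one side and the factor number `k / 2 + j` on the
other; these coincide once that factor is the stabilizing vector and the two diagrams are `lam k j`
and `lam k (j + 1)`. -/
theorem levelEmbed_tensorAtLevel (hτ : τ ∈ tailClass k) (v : ∀ i, PathSpace (τ i) (τ (i + 1)))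
    {j : ℕ} (hj : τ (k / 2 + j) = lam k j) (hj' : τ (k / 2 + j + 1) = lam k (j + 1))
    (hv : v (k / 2 + j) = stab k h τ (k / 2 + j)) :
    levelEmbed k h hh j (tensorAtLevel v j) = tensorAtLevel v (j + 1) := by
  apply coeff_injective
  ext w
  rw [coeff_tensorAtLevel hτ v hj']
  change coeff (concat (tensorAtLevel v j) (h j)) w
    = coeff (concat (tensorUpTo v (k / 2 + j)) (v (k / 2 + j))) w
  have hs : (τ (k / 2 + j)).1 + (τ (k / 2 + j)).2 = (lam k j).1 + (lam k j).2 := by rw [hj]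
  rw [coeff_concat, coeff_concat, coeff_tensorAtLevel hτ v hj, hv, coeff_stab hj hj', hs]

theorem tailClass_eventually_level (hτ : τ ∈ tailClass k) :
    ∀ᶠ j in atTop, τ (k / 2 + j) = lam k j := by
  have h1 := (tendsto_add_atTop_nat (k / 2)).eventually (tailClass_eventually hτ)
  filter_upwards [h1] with j hj
  rwa [Nat.add_sub_cancel, add_comm] at hj

theorem levelEmbed_tensorAtLevel_eventually (hτ : τ ∈ tailClass k) (v : StabSeq (stab k h τ)) :
    ∀ᶠ j in atTop, tensorAtLevel v.1 (j + 1) = levelEmbed k h hh j (tensorAtLevel v.1 j) := by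
  have h1 := tailClass_eventually_level hτ
  have h2 := (tendsto_add_atTop_nat (k / 2)).eventually v.2
  filter_upwards [h1, (tendsto_add_atTop_nat 1).eventually h1, h2] with j hj hj' hv
  rw [add_comm j] at hv
  exact (levelEmbed_tensorAtLevel hh hτ v.1 hj hj' hv).symm

/-- The element of the algebraic inductive limit corresponding to a simple tensor. -/
def tensorPreLimit (hτ : τ ∈ tailClass k) (v : StabSeq (stab k h τ)) :
    PreLimit (levelEmbed k h hh) :=
  PreLimit.mk _ (fun j => tensorAtLevel v.1 j) (levelEmbed_tensorAtLevel_eventually hh hτ v)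

theorem inner_tensorPreLimit (hτ : τ ∈ tailClass k) (v w : StabSeq (stab k h τ)) :
    inner ℂ (tensorPreLimit hh hτ v : Space k h hh) (tensorPreLimit hh hτ w : Space k h hh)
      = tensorKernel (stab k h τ) v w := by
  refine inner_coe_of_eventually ?_
  -- Level `j` of the limit carries the first `k / 2 + j` factors, because `k + 2 * j = k % 2 + 2 *
  -- (k / 2 + j)`. The truncated product must be shifted accordingly.
  have h1 := (tendsto_add_atTop_nat (k / 2)).eventually
    (tensorKernel_eventually (stab_norm hh hτ) v w)
  filter_upwards [tailClass_eventually_level hτ, h1] with j hj hj'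
  rw [hj', add_comm j]
  exact inner_tensorAtLevel hτ v.1 w.1 hj

/-- The natural isometry of the incomplete tensor product to the inductive limit. -/
def tensorEmbed (τ : tailClass k) : TensorSpace k h hh τ →ₗᵢ[ℂ] Space k h hh :=
  tensorLift (stab_norm hh τ.2) (fun v => (tensorPreLimit hh τ.2 v : Space k h hh))
    (inner_tensorPreLimit hh τ.2)

theorem tensorEmbed_simpleTensor (τ : tailClass k) (v : StabSeq (stab k h τ.1)) :
    tensorEmbed hh τ (simpleTensor _ _ v) = (tensorPreLimit hh τ.2 v : Space k h hh) :=
  tensorLift_simpleTensor _ _ _ _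

theorem tensorEmbed_simpleTensor_eq_toLimit (τ : tailClass k) (v : StabSeq (stab k h τ.1)) (j : ℕ)
    (hj : ∀ i, k / 2 + j ≤ i → τ.1 i = lam k (i - k / 2) ∧ v.1 i = stab k h τ.1 i) :
    tensorEmbed hh τ (simpleTensor _ _ v)
      = toLimit (levelEmbed k h hh) j (tensorAtLevel v.1 j) := by
  rw [tensorEmbed_simpleTensor]
  refine (toLimit_eq_coe (u := tensorPreLimit hh τ.2 v) j fun i hi => ?_).symm
  refine (levelEmbed_tensorAtLevel hh τ.2 v.1 ?_ ?_ (hj _ (by omega)).2).symm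
  · rw [(hj (k / 2 + i) (by omega)).1, Nat.add_sub_cancel_left]
  · rw [(hj (k / 2 + i + 1) (by omega)).1, add_assoc, Nat.add_sub_cancel_left]

/-- By linearity and continuity in each argument this reduces to simple tensors. Once the level
exceeds an index where the two chains differ, their representatives have disjoint supports. -/
theorem inner_tensorEmbed_of_ne {τ τ' : tailClass k} (hne : τ ≠ τ') (x : TensorSpace k h hh τ)
    (y : TensorSpace k h hh τ') : inner ℂ (tensorEmbed hh τ x) (tensorEmbed hh τ' y) = 0 := by
  induction x using simpleTensor_induction with
  | hclosed =>
    exact isClosed_eq ((tensorEmbed hh τ).continuous.inner continuous_const) continuous_const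
  | zero => simp
  | add x x' hx hx' => rw [map_add, inner_add_left, hx, hx', add_zero]
  | smul c x hx => rw [map_smul, inner_smul_left, hx, mul_zero]
  | simple v =>
    induction y using simpleTensor_induction with
    | hclosed =>
      exact isClosed_eq (continuous_const.inner (tensorEmbed hh τ').continuous) continuous_const
    | zero => simp
    | add x x' hx hx' => rw [map_add, inner_add_right, hx, hx', add_zero]
    | smul c x hx => rw [map_smul, inner_smul_right, hx, mul_zero]
    | simple w =>
      rw [tensorEmbed_simpleTensor, tensorEmbed_simpleTensor]
      refine inner_coe_of_eventually ?_
      obtain ⟨i, hi⟩ : ∃ i, τ.1 i ≠ τ'.1 i := by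
        by_contra! hcon
        exact hne (Subtype.ext (funext hcon))
      filter_upwards [tailClass_eventually_level τ.2, tailClass_eventually_level τ'.2,
        eventually_ge_atTop i] with j h1 h2 h3
      exact inner_tensorAtLevel_of_ne τ.2 τ'.2 v.1 w.1 (by omega) hi h1 h2

end Levels


/-! ### Density of the simple tensors -/

section Density

variable {k : ℕ}

/-- The sequence of the diagrams passed by a path to `(k + j, j)` at the levels of the parity of
`k`, continued by the diagrams `(k + i, i)`. -/
def pathShapes (k j : ℕ) (t : List (Fin 2)) (i : ℕ) : ℕ × ℕ :=
  if i ≤ k / 2 + j then endpoint (0, 0) (t.take (k % 2 + 2 * i)) else lam k (i - k / 2)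

variable {j : ℕ} {t : List (Fin 2)}

theorem pathShapes_of_le {i : ℕ} (hi : i ≤ k / 2 + j) :
    pathShapes k j t i = endpoint (0, 0) (t.take (k % 2 + 2 * i)) := if_pos hi

/-- The two branches of the definition agree at the index `k / 2 + j`, where the path ends, so
either description may be used there. -/
theorem pathShapes_of_ge (ht : IsPath (0, 0) t (lam k j)) {i : ℕ} (hi : k / 2 + j ≤ i) :
    pathShapes k j t i = lam k (i - k / 2) := by
  rcases hi.eq_or_lt with rfl | hi
  · rw [pathShapes_of_le le_rfl, List.take_of_length_le ht.length_lam.le, ht.endpoint_eq,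
      Nat.add_sub_cancel_left]
  · exact if_neg (by omega)

theorem pathShapes_mem (ht : IsPath (0, 0) t (lam k j)) : pathShapes k j t ∈ tailClass k := by
  have hl := ht.length_lam
  refine ⟨⟨fun i => ?_, ?_⟩, ?_⟩
  · refine ⟨?_, ?_, ?_⟩
    · rcases le_total i (k / 2 + j) with hi | hi
      · rw [pathShapes_of_le hi]
        exact (ht.take _).isDiagram_right
      · rw [pathShapes_of_ge ht hi]
        simp only [IsDiagram, lam]
        omega
    · rcases le_total i (k / 2 + j) with hi | hi
      · rw [pathShapes_of_le hi, endpoint_size, List.length_take]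
        omega
      · rw [pathShapes_of_ge ht hi]
        simp only [lam]
        omega
    · rcases Nat.lt_or_ge i (k / 2 + j) with hi | hi
      · rw [pathShapes_of_le hi.le, pathShapes_of_le hi, Nat.mul_succ, ← Nat.add_assoc,
          List.take_add (i := k % 2 + 2 * i), endpoint_append]
        exact le_endpoint _ _
      · rw [pathShapes_of_ge ht hi, pathShapes_of_ge ht (by omega)]
        constructor <;> simp only [lam] <;> omega
  · filter_upwards [eventually_ge_atTop (k / 2 + j)] with i hi
    rw [IsNice, pathShapes_of_ge ht hi, pathShapes_of_ge ht (by omega)]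
    apply Prod.ext <;> simp only [lam] <;> omega
  · filter_upwards [eventually_ge_atTop (k / 2 + j)] with i hi
    rw [pathShapes_of_ge ht hi]
    simp [lam]

theorem pathShapes_segment (ht : IsPath (0, 0) t (lam k j)) {i : ℕ} (hi : i < k / 2 + j) :
    IsPath (pathShapes k j t i) ((t.drop (k % 2 + 2 * i)).take 2) (pathShapes k j t (i + 1)) := by
  rw [pathShapes_of_le hi.le, pathShapes_of_le hi]
  exact ht.segment _ _

variable (h : ∀ j, PathSpace (lam k j) (lam k (j + 1)))

/-- The segments of a path as the factors of a simple tensor. -/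
def pathFactors (j : ℕ) (t : List (Fin 2)) : StabSeq (stab k h (pathShapes k j t)) :=
  ⟨fun i => if i < k / 2 + j then
      ofCoeff _ _ fun s => if s = (t.drop (k % 2 + 2 * i)).take 2 then 1 else 0
    else stab k h _ i, by
    filter_upwards [eventually_ge_atTop (k / 2 + j)] with i hi
    exact if_neg (by omega)⟩

theorem pathFactors_of_ge {i : ℕ} (hi : k / 2 + j ≤ i) :
    (pathFactors h j t).1 i = stab k h (pathShapes k j t) i := if_neg (by omega)

theorem coeff_pathFactors (ht : IsPath (0, 0) t (lam k j)) {i : ℕ} (hi : i < k / 2 + j)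
    (s : List (Fin 2)) : coeff ((pathFactors h j t).1 i) s
      = if s = (t.drop (k % 2 + 2 * i)).take 2 then 1 else 0 := by
  have e : (pathFactors h j t).1 i = ofCoeff _ _ fun s =>
    if s = (t.drop (k % 2 + 2 * i)).take 2 then 1 else 0 := if_pos hi
  rw [e]
  refine congrFun (coeff_ofCoeff fun w hw => if_neg ?_) s
  rintro rfl
  exact hw (pathShapes_segment ht hi)

/-- The prefix of length `a` and the consecutive pairs exhaust a word of length `a + 2 * n`. -/
theorem eq_of_segments_eq {a n : ℕ} {s t : List (Fin 2)} (hs : s.length = a + 2 * n)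
    (ht : t.length = a + 2 * n) (h0 : s.take a = t.take a)
    (h : ∀ i < n, (s.drop (a + 2 * i)).take 2 = (t.drop (a + 2 * i)).take 2) : s = t := by
  have key : ∀ m ≤ n, s.take (a + 2 * m) = t.take (a + 2 * m) := by
    intro m hm
    induction m with
    | zero => exact h0
    | succ m ih =>
      rw [Nat.mul_succ, ← Nat.add_assoc, List.take_add (i := a + 2 * m), ih (by omega),
        h m (by omega), ← List.take_add]
  have := key n le_rfl
  rwa [List.take_of_length_le hs.le, List.take_of_length_le ht.le] at this

theorem coeff_single {p q : ℕ × ℕ} (t : YoungPath p q) (w : List (Fin 2)) :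
    coeff (EuclideanSpace.single t (1 : ℂ)) w = if w = t.1 then 1 else 0 := by
  by_cases hw : IsPath p w q
  · rw [coeff, dif_pos hw, PiLp.single_apply]
    simp only [Subtype.ext_iff]
  · rw [supp_coeff _ _ hw, if_neg]
    rintro rfl
    exact hw t.2

/-- The coefficient at `w` is a product of indicators that the segments of `w` and `t` agree. The
prefixes agree automatically, so the product is the indicator of `w = t`. -/
theorem tensorAtLevel_pathFactors (ht : IsPath (0, 0) t (lam k j)) :
    tensorAtLevel (pathFactors h j t).1 j = EuclideanSpace.single ⟨t, ht⟩ (1 : ℂ) := by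
  apply coeff_injective
  ext w
  by_cases hw : IsPath (0, 0) w (lam k j)
  · rw [coeff_tensorAtLevel_of_isPath _ hw, coeff_single]
    rw [Finset.prod_congr rfl fun i hi => coeff_pathFactors h ht (Finset.mem_range.1 hi) _]
    split_ifs with e
    · subst e
      simp
    · by_contra hne
      rw [← ne_eq, Finset.prod_ne_zero_iff] at hne
      have hw' := hw.length_lam
      have ht' := ht.length_lam
      refine e (eq_of_segments_eq hw' ht' ?_ fun i hi => ?_)
      · rw [hw.take_parity (parity_le_one k) (by omega),
          ht.take_parity (parity_le_one k) (by omega)]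
      · by_contra hcon
        exact hne i (Finset.mem_range.2 hi) (if_neg hcon)
  · rw [supp_coeff _ _ hw, supp_coeff _ _ hw]

variable {h} (hh : ∀ j, ‖h j‖ = 1)

theorem tensorEmbed_pathFactors (ht : IsPath (0, 0) t (lam k j)) :
    tensorEmbed hh ⟨pathShapes k j t, pathShapes_mem ht⟩ (simpleTensor _ _ (pathFactors h j t))
      = toLimit (levelEmbed k h hh) j (EuclideanSpace.single ⟨t, ht⟩ (1 : ℂ)) := by
  rw [tensorEmbed_simpleTensor_eq_toLimit hh _ _ j fun i hi =>
    ⟨pathShapes_of_ge ht hi, pathFactors_of_ge h hi⟩, tensorAtLevel_pathFactors h ht]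

/-- For totality it suffices to reach the basis vectors of every level, and each lies in the range
attached to the chain of its own path. -/
theorem isHilbertSum_tensorEmbed :
    IsHilbertSum ℂ (fun τ : tailClass k => TensorSpace k h hh τ) (tensorEmbed hh) := by
  refine IsHilbertSum.mk (fun _ _ hne x y => inner_tensorEmbed_of_ne hh hne x y) fun x _ => ?_
  refine limit_mem_of_toLimit_mem _ (Submodule.isClosed_topologicalClosure _) (fun j v => ?_) x
  refine Submodule.le_topologicalClosure _ ?_
  change toLimitLinear (levelEmbed k h hh) j v ∈ _
  rw [← (EuclideanSpace.basisFun _ ℂ).sum_repr v, map_sum]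
  refine Submodule.sum_mem _ fun t _ => ?_
  rw [map_smul, EuclideanSpace.basisFun_apply]
  refine Submodule.smul_mem _ _ (Submodule.mem_iSup_of_mem
    (⟨pathShapes k j t.1, pathShapes_mem t.2⟩ : tailClass k) ?_)
  exact ⟨_, tensorEmbed_pathFactors hh t.2⟩

end Density

/-! ### The components are not invariant -/

/-- Young's form is local: a prefix of the word enters only through the diagram at which it ends. -/
theorem youngFun_append (p : ℕ × ℕ) (i : ℕ) (f : List (Fin 2) → ℂ) (v w : List (Fin 2)) :
    youngFun p (v.length + i) f (v ++ w) = youngFun (endpoint p v) i (fun u => f (v ++ u)) w := by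
  induction v generalizing p f with
  | nil =>
    rw [List.length_nil, Nat.zero_add]
    rfl
  | cons a v ih =>
    rw [List.length_cons, Nat.add_right_comm, List.cons_append, youngFun_cons, ih]
    rfl

section Invariance

variable {k : ℕ}

theorem exists_isPath {p q : ℕ × ℕ} (hp : IsDiagram p) (hq : IsDiagram q) (hle : p ≤ q)
    (hs : q.1 + q.2 = p.1 + p.2 + 2) : ∃ s, IsPath p s q := by
  obtain ⟨a, b⟩ := p
  obtain ⟨c, d⟩ := q
  obtain ⟨h1, h2⟩ := hle
  simp only [IsDiagram] at hp hq hs h1 h2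
  -- The two cells go to the first row, one to each row, or both to the second row. In the mixed
  -- case filling the first row first always keeps the intermediate shape a diagram; in the last
  -- case the intermediate shape is a diagram because the final one is.
  obtain ⟨rfl, rfl⟩ | ⟨rfl, rfl⟩ | ⟨rfl, rfl⟩ :
      (c = a + 2 ∧ d = b) ∨ (c = a + 1 ∧ d = b + 1) ∨ (c = a ∧ d = b + 2) := by omega
  · exact ⟨[0, 0], by simp [IsPath, IsDiagram, addCell]; omega⟩
  · exact ⟨[0, 1], by simp [IsPath, IsDiagram, addCell]; omega⟩
  · exact ⟨[1, 1], by simp [IsPath, IsDiagram, addCell]; omega⟩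

theorem exists_path_through {τ : ℕ → ℕ × ℕ} (hτ : τ ∈ tailClass k) (n : ℕ) :
    ∃ t, IsPath (0, 0) t (τ n) ∧
      ∀ i ≤ n, endpoint (0, 0) (t.take (k % 2 + 2 * i)) = τ i := by
  induction n with
  | zero =>
    have ht := isPath_of_size_le_one (hτ.1.1 0).1 (parity_le_one k) (tailClass_size hτ 0)
    refine ⟨_, ht, fun i hi => ?_⟩
    obtain rfl : i = 0 := by omega
    rw [List.take_of_length_le (by simp), ht.endpoint_eq]
  | succ n ih =>
    obtain ⟨t, ht, hi⟩ := ih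
    have h1 := tailClass_size hτ n
    have h2 := tailClass_size hτ (n + 1)
    obtain ⟨s, hs⟩ := exists_isPath (hτ.1.1 n).1 (hτ.1.1 (n + 1)).1 (hτ.1.1 n).2.2 (by omega)
    have hts := ht.append hs
    have hl := hts.length
    have hl' := ht.length
    refine ⟨t ++ s, hts, fun i hi' => ?_⟩
    rcases Nat.lt_or_ge n i with h3 | h3
    · obtain rfl : i = n + 1 := by omega
      rw [List.take_of_length_le (by simp only at hl; omega), hts.endpoint_eq]
    · rw [List.take_append_of_le_length (by simp only at hl'; omega), hi i h3]

/-- In the stable range the segment `[0, 1]` adds one cell to each row, so two further such segments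
continue the path along the same chain. -/
theorem pathShapes_append {τ : ℕ → ℕ × ℕ} {j : ℕ}
    (hτ : ∀ i, k / 2 + j ≤ i → τ i = lam k (i - k / 2)) {t : List (Fin 2)}
    (ht : IsPath (0, 0) t (lam k j))
    (hi : ∀ i ≤ k / 2 + j, endpoint (0, 0) (t.take (k % 2 + 2 * i)) = τ i)
    (ht' : IsPath (0, 0) (t ++ [0, 1, 0, 1]) (lam k (j + 2))) :
    pathShapes k (j + 2) (t ++ [0, 1, 0, 1]) = τ := by
  have hl := ht.length_lam
  ext1 i
  rcases Nat.lt_or_ge i (k / 2 + (j + 2)) with h1 | h1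
  · rw [pathShapes_of_le h1.le]
    rcases Nat.lt_or_ge (k / 2 + j) i with h2 | h2
    · obtain rfl : i = k / 2 + j + 1 := by omega
      rw [hτ _ (by omega), Nat.mul_succ, ← Nat.add_assoc, ← hl, List.take_length_add_append,
        endpoint_append, ht.endpoint_eq]
      apply Prod.ext <;> simp [endpoint, addCell, lam] <;> omega
    · rw [List.take_append_of_le_length (by omega), hi i h2]
  · rw [pathShapes_of_ge ht' h1, hτ i (by omega)]

variable {h : ∀ j, PathSpace (lam k j) (lam k (j + 1))} (hh : ∀ j, ‖h j‖ = 1)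

theorem rep_coxeter_toLimit {i j : ℕ} (hi : i + 2 ≤ k + 2 * j)
    (v : PathSpace (0, 0) (lam k j)) :
    rep k h hh (coxeter i) (toLimit (levelEmbed k h hh) j v)
      = toLimit (levelEmbed k h hh) j (youngOp (0, 0) (lam k j) i v) := by
  rw [rep, liftCoxeter_coxeter]
  exact limitMap_toLimit _ _ j
    (fun l hl v => embed_youngOp (h l) (hh l) i (by simp only [lam]; omega) v) v

theorem exists_rep_notMem_range (τ : tailClass k) :
    ∃ (g : InfSym) (x : TensorSpace k h hh τ),
      rep k h hh g (tensorEmbed hh τ x) ∉ Set.range (tensorEmbed hh τ) := by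
  obtain ⟨j, hj⟩ := eventually_atTop.1 (tailClass_eventually τ.2)
  have hτ : ∀ i, k / 2 + j ≤ i → τ.1 i = lam k (i - k / 2) := fun i hi => hj i (by omega)
  obtain ⟨t, ht, hi⟩ := exists_path_through τ.2 (k / 2 + j)
  rw [hτ _ le_rfl, Nat.add_sub_cancel_left] at ht
  have hl := ht.length_lam
  -- The two words differ by exchanging the middle cells of the last four. Both end at `lam k (j +
  -- 2)`, but halfway through the last four cells the first is at `(k + j + 1, j + 1)` and the
  -- second at `(k + j + 2, j)`.
  have h1 : IsPath (0, 0) (t ++ [0, 1, 0, 1]) (lam k (j + 2)) :=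
    ht.append (by simp [IsPath, IsDiagram, addCell, lam]; omega)
  have h2 : IsPath (0, 0) (t ++ [0, 0, 1, 1]) (lam k (j + 2)) :=
    ht.append (by simp [IsPath, IsDiagram, addCell, lam]; omega)
  have e1 := pathShapes_append hτ ht hi h1
  -- Replacing `τ` by the chain of the first path puts the basis vector of that path directly into
  -- the tensor space of `τ`.
  obtain rfl : (⟨_, pathShapes_mem h1⟩ : tailClass k) = τ := Subtype.ext e1
  -- Counting from zero, the middle cells occupy positions `t.length + 1` and `t.length + 2`: the
  -- second cell of one segment and the first of the next.
  refine ⟨coxeter (t.length + 1), simpleTensor _ _ (pathFactors h _ _), ?_⟩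
  rintro ⟨y, hy⟩
  rw [tensorEmbed_pathFactors hh h1, rep_coxeter_toLimit hh (by omega)] at hy
  have hne : (⟨_, pathShapes_mem h2⟩ : tailClass k) ≠ ⟨_, pathShapes_mem h1⟩ := by
    intro e
    have e2 := congrFun (congrArg Subtype.val e) (k / 2 + j + 1)
    simp only at e2
    rw [pathShapes_of_le (by omega), pathShapes_of_le (by omega), Nat.mul_succ, ← Nat.add_assoc,
      ← hl, List.take_length_add_append, List.take_length_add_append, endpoint_append,
      endpoint_append] at e2
    simp [endpoint, addCell] at e2
  -- If the image lay in the summand of `τ`, it would be orthogonal to the basis vector of the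
  -- second path. That inner product is the off-diagonal entry of Young's form.
  have h3 := inner_tensorEmbed_of_ne hh hne (simpleTensor _ _ (pathFactors h _ _)) y
  rw [hy, tensorEmbed_pathFactors hh h2, inner_toLimit, EuclideanSpace.inner_single_left,
    ← coeff_apply, coeff_youngOp, youngFun_append, youngFun_cons, youngFun_zero_01] at h3
  -- The exchange takes place above `(k + j + 1, j)`, whose rows differ by `k + 1`; hence the axial
  -- distance `k + 2`, which exceeds `1` and makes the square root positive.
  have hd : rowDist (addCell (endpoint (0, 0) t) 0) = k + 2 := by
    rw [ht.endpoint_eq]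
    simp [rowDist, addCell, lam]
    ring
  have hpos : (0 : ℝ) < 1 - ((k + 2 : ℝ)⁻¹) ^ 2 := by
    have h4 : (k + 2 : ℝ)⁻¹ < 1 := inv_lt_one_of_one_lt₀ (by
      have : (0 : ℝ) ≤ k := Nat.cast_nonneg k
      linarith)
    have h5 : (0 : ℝ) ≤ (k + 2 : ℝ)⁻¹ := by positivity
    nlinarith
  rw [hd, coeff_single, coeff_single, if_neg (by simp), if_pos rfl, mul_zero, zero_add, mul_one,
    map_one, one_mul, Complex.ofReal_eq_zero] at h3
  exact (Real.sqrt_pos.2 hpos).ne' h3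

end Invariance

end SchurWeyl

end

theorem mainTheorem7 (k : ℕ) (hk : 1 ≤ k)
    (h : ∀ j, SchurWeyl.PathSpace (SchurWeyl.lam k j) (SchurWeyl.lam k (j + 1)))
    (hh : ∀ j, ‖h j‖ = 1) :
    ∃ U : ∀ τ : SchurWeyl.tailClass k,
        SchurWeyl.TensorSpace k h hh τ →ₗᵢ[ℂ] SchurWeyl.Space k h hh,
      (∀ (τ : SchurWeyl.tailClass k) (v : SchurWeyl.StabSeq (SchurWeyl.stab k h τ.1)) (j : ℕ),
        (∀ i, k / 2 + j ≤ i →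
          τ.1 i = SchurWeyl.lam k (i - k / 2) ∧ v.1 i = SchurWeyl.stab k h τ.1 i) →
        U τ (SchurWeyl.simpleTensor _ _ v) =
          SchurWeyl.toLimit (SchurWeyl.levelEmbed k h hh) j (SchurWeyl.tensorAtLevel v.1 j)) ∧
      IsHilbertSum ℂ (fun τ => SchurWeyl.TensorSpace k h hh τ) U ∧
      ∀ τ : SchurWeyl.tailClass k, ∃ (g : SchurWeyl.InfSym) (x : SchurWeyl.TensorSpace k h hh τ),
        SchurWeyl.rep k h hh g (U τ x) ∉ Set.range (U τ) := by
  exact ⟨SchurWeyl.tensorEmbed hh, SchurWeyl.tensorEmbed_simpleTensor_eq_toLimit hh,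
    SchurWeyl.isHilbertSum_tensorEmbed hh, SchurWeyl.exists_rep_notMem_range hh⟩
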